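/- Conventions. A cleavage of a functor $q\colon X\to B$ chooses, for every object $x$ of $X$ and every arrow $f\colon b\to q(x)$ of $B$, a cartesian arrow over $f$ with codomain $x$ (no splitting is required); a fibration, or fibred category over $B$, is a functor equipped with a cleavage. $\mathbf{Fib}_B$ is the strict 2-category of fibred categories over $B$, whose 1-cells are the fibred functors (functors strictly over $B$ that preserve cartesian arrows, not necessarily the cleavages) and whose 2-cells are the vertical natural transformations. For $a\in A$, let $y(a)$ be the domain fibration $A/a\to A$; an arrow $k\colon a\to a'$ induces a fibred functor $y(k)\colon y(a)\to y(a')$ by postcomposition. For a fibration $p\colon A\to B$, the oplax sum $\Sigma_p\colon\mathbf{Fib}_A\to\mathbf{Fib}_B$ is the 2-functor given by postcomposition with $p$. The oplax base change $\Delta_p$ is defined as follows. For $F\in\mathbf{Fib}_B$, an object of $\Delta_p(F)$ over $a\in A$ is a fibred functor $e\colon\Sigma_p(y(a))\to F$ over $B$; an arrow $(a,e)\to(a',e')$ over $k\colon a\to a'$ is a vertical natural transformation $e\Rightarrow e'\circ\Sigma_p(y(k))$; identities are identity 2-cells and composition is pasting. The chosen lift of $k$ at $(a',e')$ is the identity 2-cell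 of $e'\circ\Sigma_p(y(k))$. On 1-cells $g\colon F\to F'$, $\Delta_p$ acts by postcomposition and whiskering with $g$; on 2-cells it acts by whiskering. The fibred categories are taken in a universe large enough to contain $\Delta_p(F)$. Theorem. Let $p\colon A\to B$ be a fibration. Then $\Delta_p\colon\mathbf{Fib}_B\to\mathbf{Fib}_A$ is a strict 2-functor, and: (1) For all $F\in\mathbf{Fib}_B$ and $a\in A$, the functor $\mathbf{Fib}_B(\Sigma_p(y(a)),F)\to\Delta_p(F)_a$, $e\mapsto(a,e)$, onto the fibre over $a$ is an isomorphism of categories. (2) $\Delta_p$ is right pseudo-adjoint to $\Sigma_p$, with the following transposition. For $E\in\mathbf{Fib}_A$ and $F\in\mathbf{Fib}_B$ the functor $$\sharp_{E,F}\colon\mathbf{Fib}_A(E,\Delta_p F)\to\mathbf{Fib}_B(\Sigma_pE,F)$$ sends $\varphi$ to the fibred functor $\varphi^\sharp$ with $\varphi^\sharp(e)=\varphi(e)(a,1_a)$ for $e\in E$ over $a$ and, for $m\colon e\to e'$ over $k\colon a\to a'$, $$\varphi^\sharp(m)=\Bigl(\varphi(e)(a,1_a)\xrightarrow{\ \varphi(m)_{(a,1_a)}\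 }\varphi(e')(a,k)\xrightarrow{\ \varphi(e')(k)\ }\varphi(e')(a',1_{a'})\Bigr);$$ it sends a 2-cell $\theta$ to the 2-cell with components $\theta(e)_{(a,1_a)}$. Every $\sharp_{E,F}$ is an equivalence of categories. The $\sharp_{E,F}$ are strictly pseudo-natural: for all fibred functors $f\colon E'\to E$ over $A$, $g\colon F\to F'$ over $B$ and $\varphi\colon E\to\Delta_pF$ one has $$g\circ\varphi^\sharp\circ\Sigma_p(f)=(\Delta_p(g)\circ\varphi\circ f)^\sharp,$$ and the corresponding identity 2-cells are the pseudo-naturality cells of a pseudo-adjunction $\Sigma_p\dashv\Delta_p$: they are natural in $\varphi$ and in the 2-cells between the $f$'s and between the $g$'s, and they satisfy the unit and composition coherence laws. -/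

import Mathlib

open CategoryTheory

universe w' w v u v₁ u₁ v₂ u₂ v₃ u₃ v₄ u₄

namespace Fibred

section Cartesian

variable {X : Type u₂} [Category.{v₂} X] {B : Type u₁} [Category.{v₁} B]

/-- A cartesian arrow (over its own image in the base). -/
abbrev IsCart (p : X ⥤ B) {x y : X} (φ : x ⟶ y) : Prop :=
  p.IsStronglyCartesian (p.map φ) φ

theorem isCart_of_lift (p : X ⥤ B) {b b' : B} {x y : X} (f : b ⟶ b') (φ : x ⟶ y)
    [h : p.IsStronglyCartesian f φ] : IsCart p φ := by
  obtain ⟨⟩ := (inferInstance : p.IsHomLift f φ)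
  exact h

theorem isCart_iff (p : X ⥤ B) {x y : X} (φ : x ⟶ y) :
    IsCart p φ ↔ ∀ ⦃z : X⦄ (g : p.obj z ⟶ p.obj x) (ψ : z ⟶ y), p.map ψ = g ≫ p.map φ →
      ∃! χ : z ⟶ x, p.map χ = g ∧ χ ≫ φ = ψ := by
  constructor
  · intro h z g ψ hψ
    have : p.IsHomLift (g ≫ p.map φ) ψ := hψ ▸ inferInstance
    obtain ⟨χ, ⟨h1, h2⟩, h3⟩ := h.universal_property' g ψ
    refine ⟨χ, ⟨(IsHomLift.eq_of_isHomLift p g χ).symm, h2⟩, ?_⟩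
    rintro χ' ⟨rfl, h2'⟩
    exact h3 χ' ⟨inferInstance, h2'⟩
  · intro h
    refine { universal_property' := ?_ }
    intro z g ψ hψ
    obtain ⟨χ, ⟨h1, h2⟩, h3⟩ := h g ψ (IsHomLift.eq_of_isHomLift p _ ψ).symm
    refine ⟨χ, ⟨h1 ▸ inferInstance, h2⟩, ?_⟩
    rintro χ' ⟨h1', h2'⟩
    exact h3 χ' ⟨(IsHomLift.eq_of_isHomLift p g χ').symm, h2'⟩

theorem isCart_comp (p : X ⥤ B) {x y z : X} {φ : x ⟶ y} {ψ : y ⟶ z}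
    (hφ : IsCart p φ) (hψ : IsCart p ψ) : IsCart p (φ ≫ ψ) := by
  unfold IsCart
  rw [p.map_comp]
  infer_instance

theorem isCart_of_isIso (p : X ⥤ B) {x y : X} (φ : x ⟶ y) [IsIso φ] : IsCart p φ := by
  infer_instance

theorem isCart_of_comp (p : X ⥤ B) {x y z : X} {φ : x ⟶ y} {ψ : y ⟶ z}
    (hψ : IsCart p ψ) (h : IsCart p (φ ≫ ψ)) : IsCart p φ := by
  unfold IsCart at h
  rw [p.map_comp] at h
  exact Functor.IsStronglyCartesian.of_comp p (f := p.map φ) (g := p.map ψ) (φ := φ) (ψ := ψ)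

/-- Cartesian arrows for both functors are cartesian for the composite functor. -/
theorem isCart_comp_functor {A : Type u₃} [Category.{v₃} A] (q : X ⥤ A) (p : A ⥤ B) {x y : X}
    {φ : x ⟶ y} (hq : IsCart q φ) (hp : IsCart p (q.map φ)) : IsCart (q ⋙ p) φ := by
  rw [isCart_iff] at *
  intro z g ψ hψ
  obtain ⟨α, ⟨h1, h2⟩, h3⟩ := hp g (q.map ψ) hψ
  obtain ⟨χ, ⟨k1, k2⟩, k3⟩ := hq α ψ h2.symm
  refine ⟨χ, ⟨by simp [k1, h1], k2⟩, ?_⟩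
  rintro χ' ⟨l1, l2⟩
  exact k3 χ' ⟨h3 _ ⟨l1, by rw [← l2, q.map_comp]⟩, l2⟩

theorem stronglyCartesian_comp_functor {A : Type u₃} [Category.{v₃} A] (q : X ⥤ A) (p : A ⥤ B)
    {b b' : B} {a a' : A} {x y : X} (f : b ⟶ b') (k : a ⟶ a') (m : x ⟶ y)
    (hm : q.IsStronglyCartesian k m) (hk : p.IsStronglyCartesian f k) :
    (q ⋙ p).IsStronglyCartesian f m := by
  obtain ⟨⟩ := (inferInstance : q.IsHomLift k m)
  obtain ⟨⟩ := (inferInstance : p.IsHomLift f (q.map m))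
  exact isCart_comp_functor q p hm hk

/-- A cleavage of `p` chooses a cartesian lift of every arrow of the base with a lifted codomain;
no compatibility with identities or composition is asked for. A functor with a cleavage is a
(cloven) fibration. -/
structure Cleavage (p : X ⥤ B) where
  /-- The domain of the chosen lift. -/
  obj {b : B} (x : X) (f : b ⟶ p.obj x) : X
  /-- The chosen lift. -/
  map {b : B} (x : X) (f : b ⟶ p.obj x) : obj x f ⟶ x
  /-- The chosen lift is a cartesian arrow over the given arrow. -/
  cart {b : B} (x : X) (f : b ⟶ p.obj x) : p.IsStronglyCartesian f (map x f)

/-- Every cartesian arrow is isomorphic to the chosen lift of its image. -/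
theorem Cleavage.exists_iso {p : X ⥤ B} (c : Cleavage p) {x y : X} (φ : x ⟶ y) (hφ : IsCart p φ) :
    ∃ i : x ≅ c.obj y (p.map φ), p.IsHomLift (𝟙 (p.obj x)) i.hom ∧
      i.hom ≫ c.map y (p.map φ) = φ := by
  have := c.cart y (p.map φ)
  exact ⟨Functor.IsCartesian.domainUniqueUpToIso p (p.map φ) (c.map y (p.map φ)) φ, inferInstance,
    by simp⟩

/-- A functor that sends the chosen lifts to cartesian arrows preserves all cartesian arrows. -/
theorem Cleavage.preserves {p : X ⥤ B} (c : Cleavage p) {Y : Type u₃} [Category.{v₃} Y]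
    {B' : Type u₄} [Category.{v₄} B']
    (q : Y ⥤ B') (F : X ⥤ Y) (h : ∀ {b : B} (x : X) (f : b ⟶ p.obj x), IsCart q (F.map (c.map x f)))
    {x y : X} (φ : x ⟶ y) (hφ : IsCart p φ) : IsCart q (F.map φ) := by
  obtain ⟨i, -, hi⟩ := c.exists_iso φ hφ
  rw [← hi, F.map_comp]
  exact isCart_comp q (isCart_of_isIso q _) (h _ _)

/-- The composite of two cloven fibrations: a lift is computed in two successive steps. -/
def Cleavage.comp {A : Type u₃} [Category.{v₃} A] {q : X ⥤ A} {p : A ⥤ B} (cq : Cleavage q)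
    (cp : Cleavage p) : Cleavage (q ⋙ p) where
  obj x f := cq.obj x (cp.map (q.obj x) f)
  map x f := cq.map x (cp.map (q.obj x) f)
  cart x f := stronglyCartesian_comp_functor q p _ _ _ (cq.cart x _) (cp.cart _ f)

end Cartesian

set_option linter.checkUnivs false in
/-- A (cloven) fibred category over `B`. -/
structure FibCat (B : Type u₁) [Category.{v₁} B] extends BasedCategory.{v, u} B where
  /-- The cleavage. -/
  cleavage : Cleavage p

section Hom

variable {B : Type u₁} [Category.{v₁} B]

/-- A fibred functor over `B`: a functor strictly over `B` that preserves cartesian arrows.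
It need not respect the cleavages. -/
structure FibHom (X : FibCat.{v₂, u₂} B) (Y : FibCat.{v₃, u₃} B) extends
    BasedFunctor X.toBasedCategory Y.toBasedCategory where
  preserves : ∀ {x y : X.obj} (φ : x ⟶ y), IsCart X.p φ → IsCart Y.p (map φ)

namespace FibHom

variable {X : FibCat.{v₂, u₂} B} {Y : FibCat.{v₃, u₃} B} {Z : FibCat.{v₄, u₄} B}

theorem ext_toFunctor {F G : FibHom X Y} (h : F.toFunctor = G.toFunctor) : F = G := by
  obtain ⟨⟨F, _⟩, _⟩ := F
  obtain ⟨⟨G, _⟩, _⟩ := G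
  obtain rfl : F = G := h
  rfl

/-- The category of fibred functors; its arrows are the vertical natural transformations. -/
instance : Category (FibHom X Y) where
  Hom F G := BasedNatTrans F.toBasedFunctor G.toBasedFunctor
  id F := BasedNatTrans.id F.toBasedFunctor
  comp α β := BasedNatTrans.comp α β

/-- The component of a 2-cell. -/
abbrev app {F G : FibHom X Y} (α : F ⟶ G) (x : X.obj) : F.obj x ⟶ G.obj x :=
  BasedNatTrans.toNatTrans α |>.app x

theorem hom_ext {F G : FibHom X Y} {α β : F ⟶ G} (h : ∀ x, app α x = app β x) : α = β :=
  BasedNatTrans.ext _ _ (NatTrans.ext (funext h))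

@[simp] theorem id_app (F : FibHom X Y) (x : X.obj) : app (𝟙 F) x = 𝟙 (F.obj x) := rfl

@[simp] theorem comp_app {F G H : FibHom X Y} (α : F ⟶ G) (β : G ⟶ H) (x : X.obj) :
    app (α ≫ β) x = app α x ≫ app β x := rfl

theorem eqToHom_app {F G : FibHom X Y} (h : F = G) (x : X.obj) :
    app (eqToHom h) x = eqToHom (by rw [h]) := by
  subst h; rfl

/-- The identity fibred functor. -/
abbrev id (X : FibCat.{v₂, u₂} B) : FibHom X X where
  toBasedFunctor := BasedFunctor.id X.toBasedCategory
  preserves _ h := h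

/-- Composition of fibred functors, in diagrammatic order. -/
abbrev comp (F : FibHom X Y) (G : FibHom Y Z) : FibHom X Z where
  toBasedFunctor := BasedFunctor.comp F.toBasedFunctor G.toBasedFunctor
  preserves φ h := G.preserves _ (F.preserves φ h)

/-- Whiskering of a 2-cell with a fibred functor on the domain side. -/
def whiskerLeft (F : FibHom X Y) {G H : FibHom Y Z} (α : G ⟶ H) : F.comp G ⟶ F.comp H :=
  BasedCategory.whiskerLeft F.toBasedFunctor (G := G.toBasedFunctor) (H := H.toBasedFunctor) α

/-- Whiskering of a 2-cell with a fibred functor on the codomain side. -/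
def whiskerRight {F G : FibHom X Y} (α : F ⟶ G) (H : FibHom Y Z) : F.comp H ⟶ G.comp H :=
  BasedCategory.whiskerRight (F := F.toBasedFunctor) (G := G.toBasedFunctor) α H.toBasedFunctor

@[simp] theorem whiskerLeft_app (F : FibHom X Y) {G H : FibHom Y Z} (α : G ⟶ H) (x : X.obj) :
    app (whiskerLeft F α) x = app α (F.obj x) := rfl

@[simp] theorem whiskerRight_app {F G : FibHom X Y} (α : F ⟶ G) (H : FibHom Y Z) (x : X.obj) :
    app (whiskerRight α H) x = H.map (app α x) := rfl

end FibHom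

/-- The 2-category `Fib_B` of fibred categories, fibred functors and vertical natural
transformations. -/
instance : Bicategory (FibCat.{v, u} B) where
  Hom X Y := FibHom X Y
  id X := FibHom.id X
  comp F G := FibHom.comp F G
  homCategory X Y := inferInstanceAs (Category (FibHom X Y))
  whiskerLeft F _ _ α := FibHom.whiskerLeft F α
  whiskerRight α H := FibHom.whiskerRight α H
  associator F G H := @Iso.refl (FibHom _ _) _ (F.comp (G.comp H))
  leftUnitor F := @Iso.refl (FibHom _ _) _ F
  rightUnitor F := @Iso.refl (FibHom _ _) _ F
  whiskerLeft_id _ _ := rfl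
  whiskerLeft_comp _ _ _ _ _ _ := rfl
  id_whiskerLeft _ := FibHom.hom_ext fun _ => ((Category.id_comp _).trans (Category.comp_id _)).symm
  comp_whiskerLeft _ _ _ _ _ := FibHom.hom_ext fun _ => ((Category.id_comp _).trans (Category.comp_id _)).symm
  id_whiskerRight _ G := FibHom.hom_ext fun _ => G.map_id _
  comp_whiskerRight _ _ G := FibHom.hom_ext fun _ => G.map_comp _ _
  whiskerRight_id _ := FibHom.hom_ext fun _ => ((Category.id_comp _).trans (Category.comp_id _)).symm
  whiskerRight_comp _ _ _ := FibHom.hom_ext fun _ => ((Category.id_comp _).trans (Category.comp_id _)).symm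
  whisker_assoc _ _ _ _ _ := FibHom.hom_ext fun _ => ((Category.id_comp _).trans (Category.comp_id _)).symm
  whisker_exchange _ β := FibHom.hom_ext fun _ => ((BasedNatTrans.toNatTrans β).naturality _).symm
  pentagon _ _ _ K := FibHom.hom_ext fun _ => (congrArg (· ≫ 𝟙 _ ≫ 𝟙 _) (K.map_id _)).trans (Category.id_comp _)
  triangle _ H := FibHom.hom_ext fun _ => (Category.id_comp _).trans (H.map_id _).symm

instance : Bicategory.Strict (FibCat.{v, u} B) where

end Hom


section Yoneda

variable {A : Type u} [Category.{v} A]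

theorem isCart_over {a : A} {x y : Over a} (k : x ⟶ y) : IsCart (Over.forget a) k := by
  rw [isCart_iff]
  intro z (g : z.left ⟶ x.left) ψ (hψ : ψ.left = g ≫ k.left)
  refine ⟨Over.homMk g ?_, ⟨rfl, ?_⟩, ?_⟩
  · rw [← Over.w k, ← Over.w ψ, hψ, Category.assoc]
  · ext; exact hψ.symm
  · rintro χ ⟨h, -⟩
    ext; exact h

/-- The fibred Yoneda embedding on objects: `y a` is the domain fibration `A / a → A`. -/
abbrev yo (a : A) : FibCat.{v, max u v} A where
  obj := Over a
  p := Over.forget a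
  cleavage :=
    { obj := fun {b} x (f : b ⟶ x.left) => Over.mk (f ≫ x.hom)
      map := fun {b} x (f : b ⟶ x.left) => (Over.homMk f rfl : Over.mk (f ≫ x.hom) ⟶ x)
      cart := fun {b} x (f : b ⟶ x.left) =>
        isCart_over (Over.homMk f rfl : Over.mk (f ≫ x.hom) ⟶ x) }

/-- The fibred Yoneda embedding on arrows: postcomposition. -/
abbrev yoMap {a a' : A} (k : a ⟶ a') : FibHom (yo a) (yo a') where
  toFunctor := Over.map k
  preserves φ _ := isCart_over ((Over.map k).map φ)

theorem yoMap_id (a : A) : yoMap (𝟙 a) = FibHom.id (yo a) :=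
  FibHom.ext_toFunctor (Over.mapId_eq a)

theorem yoMap_comp {a a' a'' : A} (k : a ⟶ a') (l : a' ⟶ a'') :
    yoMap (k ≫ l) = (yoMap k).comp (yoMap l) :=
  FibHom.ext_toFunctor (Over.mapComp_eq k l)

end Yoneda

section Sum

variable {A : Type u₁} [Category.{v₁} A] {B : Type u₂} [Category.{v₂} B] {p : A ⥤ B}
  (c : Cleavage p)

/-- The oplax sum of a fibred category: postcomposition with the fibration `p`. -/
abbrev sumObj (E : FibCat.{v, u} A) : FibCat.{v, u} B where
  obj := E.obj
  p := E.p ⋙ p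
  cleavage := E.cleavage.comp c

/-- The cartesian arrows of the oplax sum over `B` are the arrows that are cartesian over `A` and
whose image in `A` is cartesian over `B`. -/
theorem isCart_sum_iff (c : Cleavage p) (E : FibCat.{v, u} A) {x y : E.obj} (φ : x ⟶ y) :
    IsCart (E.p ⋙ p) φ ↔ IsCart E.p φ ∧ IsCart p (E.p.map φ) := by
  refine ⟨fun h => ?_, fun h => isCart_comp_functor _ _ h.1 h.2⟩
  obtain ⟨i, -, hi⟩ := (E.cleavage.comp c).exists_iso φ h
  rw [← hi]
  constructor
  · exact isCart_comp _ (isCart_of_isIso _ _)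
      (@isCart_of_lift _ _ _ _ _ _ _ _ _ _ _ (E.cleavage.cart _ _))
  · rw [E.p.map_comp]
    refine isCart_comp _ (isCart_of_isIso _ _) ?_
    have h1 := E.cleavage.cart y (c.map (E.p.obj y) (p.map (E.p.map φ)))
    have h2 := c.cart (E.p.obj y) (p.map (E.p.map φ))
    have h3 := isCart_of_lift _ _ _ (h := h2)
    have h4 := IsHomLift.fac' E.p (c.map (E.p.obj y) (p.map (E.p.map φ)))
      (E.cleavage.map y (c.map (E.p.obj y) (p.map (E.p.map φ))))
    change IsCart p (E.p.map (E.cleavage.map y (c.map (E.p.obj y) (p.map (E.p.map φ)))))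
    rw [h4]
    exact isCart_comp _ (isCart_of_isIso _ _) (isCart_comp _ h3 (isCart_of_isIso _ _))

/-- The oplax sum on fibred functors. -/
abbrev sumMap {E : FibCat.{v, u} A} {E' : FibCat.{v₃, u₃} A} (f : FibHom E E') :
    FibHom (sumObj c E) (sumObj c E') where
  toFunctor := f.toFunctor
  w := congrArg (· ⋙ p) f.w
  preserves φ h := by
    rw [isCart_sum_iff c] at h ⊢
    refine ⟨f.preserves φ h.1, ?_⟩
    have h4 := IsHomLift.fac' E'.p (E.p.map φ) (f.map φ)
    rw [h4]
    exact isCart_comp _ (isCart_of_isIso _ _) (isCart_comp _ h.2 (isCart_of_isIso _ _))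

/-- The oplax sum on 2-cells. -/
def sumMap₂ {E : FibCat.{v, u} A} {E' : FibCat.{v₃, u₃} A} {f g : FibHom E E'} (α : f ⟶ g) :
    sumMap c f ⟶ sumMap c g where
  toNatTrans := BasedNatTrans.toNatTrans (F := f.toBasedFunctor) (G := g.toBasedFunctor) α
  isHomLift' x := by
    have h := IsHomLift.fac' E'.p (𝟙 (E.p.obj x)) (FibHom.app α x)
    refine IsHomLift.of_fac' _ _ _ (congrArg p.obj (IsHomLift.domain_eq E'.p (𝟙 _) (FibHom.app α x)))
      (congrArg p.obj (IsHomLift.codomain_eq E'.p (𝟙 _) (FibHom.app α x))) ?_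
    change p.map (E'.p.map (FibHom.app α x)) = _
    rw [h]
    simp [eqToHom_map]

end Sum

section BaseChange

variable {A : Type u₁} [Category.{v₁} A] {B : Type u₂} [Category.{v₂} B] {p : A ⥤ B}
  (c : Cleavage p)

theorem sum_yo_id {a : A} {F : FibCat.{v, u} B} (e : FibHom (sumObj c (yo a)) F) :
    (sumMap c (yoMap (𝟙 a))).comp e = e := by
  rw [yoMap_id]; rfl

theorem sum_yo_comp {a a' a'' : A} (k : a ⟶ a') (l : a' ⟶ a'') {F : FibCat.{v, u} B}
    (e : FibHom (sumObj c (yo a'')) F) :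
    (sumMap c (yoMap (k ≫ l))).comp e =
      (sumMap c (yoMap k)).comp ((sumMap c (yoMap l)).comp e) := by
  rw [yoMap_comp]; rfl

/-- An object of the oplax base change of `F` along `p`, displayed over `base`: a fibred functor
from the oplax sum of `y base` to `F`. -/
structure ObcObj (F : FibCat.{v, u} B) where
  base : A
  val : FibHom (sumObj c (yo base)) F

/-- An arrow of the oplax base change, displayed over `base : x.base ⟶ y.base`: a vertical natural
transformation from `x.val` to the restriction of `y.val` along the oplax sum of `y base`. -/
structure ObcHom {F : FibCat.{v, u} B} (x y : ObcObj c F) where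
  base : x.base ⟶ y.base
  cell : x.val ⟶ (sumMap c (yoMap base)).comp y.val

variable {c}

theorem FibHom.app_eq {B : Type u₂} [Category.{v₂} B] {X : FibCat.{v₃, u₃} B}
    {Y : FibCat.{v₄, u₄} B} {F G : FibHom X Y} (α : F ⟶ G) {x y : X.obj}
    (h : x = y) : FibHom.app α x = eqToHom (by rw [h]) ≫ FibHom.app α y ≫ eqToHom (by rw [h]) := by
  subst h; simp

theorem over_map_id {a : A} (z : Over a) : (Over.map (𝟙 a)).obj z = z :=
  Functor.congr_obj (Over.mapId_eq a) z

theorem over_map_comp {a a' a'' : A} (k : a ⟶ a') (l : a' ⟶ a'') (z : Over a) :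
    (Over.map (k ≫ l)).obj z = (Over.map l).obj ((Over.map k).obj z) :=
  Functor.congr_obj (Over.mapComp_eq k l) z

namespace ObcHom

variable {F : FibCat.{v, u} B}

/-- The component of the 2-cell underlying an arrow of the oplax base change. -/
def app {x y : ObcObj c F} (f : ObcHom c x y) (z : Over x.base) :
    x.val.obj z ⟶ y.val.obj ((Over.map f.base).obj z) :=
  FibHom.app f.cell z

/-- The identity: the identity 2-cell of `x.val = x.val ∘ Σ (y (𝟙 a))`. -/
abbrev id (x : ObcObj c F) : ObcHom c x x :=
  ⟨𝟙 x.base, eqToHom (sum_yo_id c x.val).symm⟩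

/-- The composite: the pasting of the 2-cells `f.cell` and `g.cell`. -/
abbrev comp {x y z : ObcObj c F} (f : ObcHom c x y) (g : ObcHom c y z) : ObcHom c x z :=
  ⟨f.base ≫ g.base, f.cell ≫ FibHom.whiskerLeft (sumMap c (yoMap f.base)) g.cell ≫
      eqToHom (sum_yo_comp c f.base g.base z.val).symm⟩

theorem ext_app {x y : ObcObj c F} {f g : ObcHom c x y} (hb : f.base = g.base)
    (h : ∀ z : Over x.base, f.app z ≫ eqToHom (by rw [hb]) = g.app z) : f = g := by
  obtain ⟨k, t⟩ := f
  obtain ⟨l, s⟩ := g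
  obtain rfl : k = l := hb
  congr 1
  refine FibHom.hom_ext fun z => ?_
  have := h z
  rw [eqToHom_refl, Category.comp_id] at this
  exact this

theorem app_eq {x y : ObcObj c F} (f : ObcHom c x y) {z w : Over x.base} (h : z = w) :
    f.app z = eqToHom (by rw [h]) ≫ f.app w ≫ eqToHom (by rw [h]) := by
  subst h; simp

theorem id_app (x : ObcObj c F) (w : Over x.base) :
    (id x).app w = eqToHom (congrArg x.val.obj (over_map_id w).symm) :=
  FibHom.eqToHom_app (sum_yo_id c x.val).symm _

theorem comp_app {x y z : ObcObj c F} (f : ObcHom c x y) (g : ObcHom c y z) (w : Over x.base) :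
    (comp f g).app w = f.app w ≫ g.app ((Over.map f.base).obj w) ≫
        eqToHom (congrArg z.val.obj (over_map_comp f.base g.base w).symm) :=
  congrArg (f.app w ≫ g.app ((Over.map f.base).obj w) ≫ ·) (FibHom.eqToHom_app _ _)

end ObcHom

/-- The total category of the oplax base change. -/
instance (F : FibCat.{v, u} B) : Category (ObcObj c F) where
  Hom x y := ObcHom c x y
  id x := ObcHom.id x
  comp f g := ObcHom.comp f g
  id_comp {x y} f := by
    refine ObcHom.ext_app (Category.id_comp f.base) fun z => ?_
    simp only [ObcHom.comp_app, ObcHom.id_app]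
    have h := ObcHom.app_eq f (over_map_id z)
    change (_ ≫ f.app ((Over.map (𝟙 x.base)).obj z) ≫ _) ≫ _ = _
    rw [h]
    simp
  comp_id {x y} f := by
    refine ObcHom.ext_app (Category.comp_id f.base) fun z => ?_
    simp only [ObcHom.comp_app, ObcHom.id_app]
    simp
  assoc {x y z w} f g h := by
    refine ObcHom.ext_app (Category.assoc f.base g.base h.base) fun z => ?_
    simp only [ObcHom.comp_app]
    have h := ObcHom.app_eq h (over_map_comp f.base g.base z)
    change (_ ≫ ObcHom.app _ ((Over.map (f.base ≫ g.base)).obj z) ≫ _) ≫ _ = _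
    rw [h]
    simp

theorem ObcHom.catId_app {F : FibCat.{v, u} B} (x : ObcObj c F) (w : Over x.base) :
    ObcHom.app (𝟙 x) w = eqToHom (congrArg x.val.obj (over_map_id w).symm) :=
  ObcHom.id_app x w

theorem ObcHom.catComp_app {F : FibCat.{v, u} B} {x y z : ObcObj c F} (f : x ⟶ y) (g : y ⟶ z)
    (w : Over x.base) :
    ObcHom.app (f ≫ g) w = ObcHom.app f w ≫ ObcHom.app g ((Over.map (ObcHom.base f)).obj w) ≫
        eqToHom (congrArg z.val.obj (over_map_comp f.base g.base w).symm) :=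
  ObcHom.comp_app f g w

/-- A 2-cell between fibred functors out of the oplax sum of `y a`, as a vertical arrow of the
oplax base change. -/
def vert {F : FibCat.{v, u} B} {a : A} {e e' : FibHom (sumObj c (yo a)) F} (t : e ⟶ e') :
    (⟨a, e⟩ : ObcObj c F) ⟶ ⟨a, e'⟩ :=
  (⟨𝟙 a, t ≫ eqToHom (sum_yo_id c e').symm⟩ : ObcHom c _ _)

theorem vert_app {F : FibCat.{v, u} B} {a : A} {e e' : FibHom (sumObj c (yo a)) F}
    (t : e ⟶ e') (w : Over a) : ObcHom.app (vert t) w =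
      FibHom.app t w ≫ eqToHom (congrArg e'.obj (over_map_id w).symm) :=
  congrArg (FibHom.app t w ≫ ·) (FibHom.eqToHom_app _ _)

variable (c) in
/-- The display functor of the oplax base change. -/
abbrev obcProj (F : FibCat.{v, u} B) : ObcObj c F ⥤ A where
  obj x := x.base
  map f := ObcHom.base f

/-- The chosen lift of `f`: the restriction of `x` along `f` is the precomposition with the oplax
sum of `y f`, and the lift is the identity 2-cell. -/
abbrev obcLift {F : FibCat.{v, u} B} {a : A} (x : ObcObj c F) (f : a ⟶ x.base) :
    (⟨a, (sumMap c (yoMap f)).comp x.val⟩ : ObcObj c F) ⟶ x :=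
  (⟨f, 𝟙 _⟩ : ObcHom c ⟨a, (sumMap c (yoMap f)).comp x.val⟩ x)

theorem comp_obcLift {F : FibCat.{v, u} B} {a : A} {z x : ObcObj c F} (f : a ⟶ x.base)
    (χ : z ⟶ ⟨a, (sumMap c (yoMap f)).comp x.val⟩) :
    χ ≫ obcLift x f = (⟨ObcHom.base χ ≫ f,
      ObcHom.cell χ ≫ eqToHom (sum_yo_comp c (ObcHom.base χ) f x.val).symm⟩ : ObcHom c z x) :=
  congrArg (fun t => (⟨ObcHom.base χ ≫ f, ObcHom.cell χ ≫ t⟩ : ObcHom c z x)) (Category.id_comp _)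

/-- The (split) cleavage of the oplax base change. -/
def obcCleavage (F : FibCat.{v, u} B) : Cleavage (obcProj c F) where
  obj {a} x f := ⟨a, (sumMap c (yoMap f)).comp x.val⟩
  map {a} x f := obcLift x f
  cart {a} x f := by
    refine (isCart_iff (obcProj c F) (obcLift x f)).2 ?_
    rintro z (g : z.base ⟶ a) ⟨k, t⟩ (rfl : k = g ≫ f)
    refine ⟨(⟨g, t ≫ eqToHom (sum_yo_comp c g f x.val)⟩ : ObcHom c _ _), ⟨rfl, ?_⟩, ?_⟩
    · rw [comp_obcLift]
      simp
    · rintro ⟨g', s⟩ ⟨(rfl : g' = g), h⟩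
      rw [comp_obcLift] at h
      cases h
      simp

/-- The oplax base change of a fibred category. -/
abbrev obcObj (c : Cleavage p) (F : FibCat.{v, u} B) :
    FibCat.{max u₁ v₁ v, max u₁ v₁ v u} A where
  obj := ObcObj c F
  p := obcProj c F
  cleavage := obcCleavage F

theorem ObcHom.naturality {F : FibCat.{v, u} B} {x y : ObcObj c F} (f : ObcHom c x y)
    {z w : Over x.base} (k : z ⟶ w) :
    x.val.map k ≫ f.app w = f.app z ≫ y.val.map ((Over.map f.base).map k) :=
  (BasedNatTrans.toNatTrans (F := x.val.toBasedFunctor)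
    (G := ((sumMap c (yoMap f.base)).comp y.val).toBasedFunctor) f.cell).naturality k

/-- Whiskering of an arrow of the oplax base change with a fibred functor. -/
abbrev ObcHom.post {F : FibCat.{v, u} B} {G : FibCat.{v₃, u₃} B} {x y : ObcObj c F}
    (k : ObcHom c x y) (f : FibHom F G) :
    ObcHom c (⟨x.base, x.val.comp f⟩ : ObcObj c G) ⟨y.base, y.val.comp f⟩ :=
  ⟨k.base, FibHom.whiskerRight k.cell f⟩

theorem ObcHom.post_app {F : FibCat.{v, u} B} {G : FibCat.{v₃, u₃} B} {x y : ObcObj c F}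
    (k : ObcHom c x y) (f : FibHom F G) (w : Over x.base) :
    (k.post f).app w = f.map (k.app w) := rfl

/-- The oplax base change on fibred functors, as a functor: postcomposition and whiskering. -/
abbrev obcMapFunctor (c : Cleavage p) {F : FibCat.{v, u} B} {G : FibCat.{v₃, u₃} B}
    (f : FibHom F G) : ObcObj c F ⥤ ObcObj c G where
  obj x := ⟨x.base, x.val.comp f⟩
  map k := ObcHom.post k f
  map_id x := by
    refine ObcHom.ext_app rfl fun w => (Category.comp_id _).trans ?_
    rw [ObcHom.post_app, ObcHom.catId_app, ObcHom.catId_app, eqToHom_map]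
    rfl
  map_comp {x y z} k l := by
    refine ObcHom.ext_app rfl fun w => (Category.comp_id _).trans ?_
    rw [ObcHom.post_app, ObcHom.catComp_app, ObcHom.catComp_app]
    change f.map (_ ≫ _ ≫ _) = f.map _ ≫ f.map _ ≫ _
    rw [f.map_comp, f.map_comp, eqToHom_map]
    rfl

theorem obcMapFunctor_obcLift (c : Cleavage p) {F : FibCat.{v, u} B} {G : FibCat.{v₃, u₃} B}
    (f : FibHom F G) {a : A} (x : ObcObj c F) (k : a ⟶ x.base) :
    (obcMapFunctor c f).map (obcLift x k) =
      obcLift (⟨x.base, x.val.comp f⟩ : ObcObj c G) k :=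
  ObcHom.ext_app rfl fun _ => (Category.comp_id _).trans (f.map_id _)

/-- The oplax base change on fibred functors. -/
abbrev obcMap (c : Cleavage p) {F : FibCat.{v, u} B} {G : FibCat.{v₃, u₃} B} (f : FibHom F G) :
    FibHom (obcObj c F) (obcObj c G) where
  toFunctor := obcMapFunctor c f
  w := rfl
  preserves φ hφ := by
    refine (obcCleavage F).preserves (obcProj c G) (obcMapFunctor c f) (fun {b} x k => ?_) φ hφ
    have h2 := (obcCleavage G).cart (⟨x.base, x.val.comp f⟩ : ObcObj c G) k
    exact (congrArg (fun q => IsCart (obcProj c G) q) (obcMapFunctor_obcLift c f x k)).mpr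
      (isCart_of_lift _ _ _ (h := h2))

theorem square_eqToHom {C : Type u} [Category.{v} C] {X Y Z Z' Z₂ Z₃ Z₄ Z₅ W : C}
    (s : X ⟶ Y) (t : Y ⟶ Z) (s' : X ⟶ Z') (t' : Z' ⟶ Z) (h : s ≫ t = s' ≫ t')
    (e₁ : Z = Z₂) (e₂ : Z₂ = Z₃) (e₃ : Z₃ = Z₄) (e₄ : Z' = W) (e₅ : W = Z') (e₆ : Z = Z₅)
    (e₇ : Z₅ = Z₄) :
    (s ≫ (t ≫ eqToHom e₁) ≫ eqToHom e₂) ≫ eqToHom e₃ =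
      (s' ≫ eqToHom e₄) ≫ (eqToHom e₅ ≫ t' ≫ eqToHom e₆) ≫ eqToHom e₇ := by
  subst e₁ e₂ e₃ e₄ e₆
  simp [h]

/-- The oplax base change on 2-cells: the component at `x` is the whiskering with `x.val`. -/
def obcMap₂ (c : Cleavage p) {F : FibCat.{v, u} B} {G : FibCat.{v₃, u₃} B} {f g : FibHom F G}
    (α : f ⟶ g) : obcMap c f ⟶ obcMap c g where
  app x := (vert (FibHom.whiskerLeft x.val α) :
    (⟨x.base, x.val.comp f⟩ : ObcObj c G) ⟶ ⟨x.base, x.val.comp g⟩)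
  naturality x y k := by
    refine ObcHom.ext_app ((Category.comp_id k.base).trans (Category.id_comp k.base).symm)
      fun w => ?_
    rw [ObcHom.catComp_app, ObcHom.catComp_app]
    erw [vert_app, vert_app]
    change (f.map (ObcHom.app k w) ≫
      (FibHom.app α (y.val.obj ((Over.map (ObcHom.base k)).obj w)) ≫ _) ≫ _) ≫ _ =
      (FibHom.app α (x.val.obj w) ≫ _) ≫
        g.map (ObcHom.app k ((Over.map (𝟙 x.base)).obj w)) ≫ _
    have h1 := congrArg g.map (ObcHom.app_eq k (over_map_id w))
    rw [g.map_comp, g.map_comp, eqToHom_map, eqToHom_map] at h1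
    have h2 := (BasedNatTrans.toNatTrans (F := f.toBasedFunctor)
      (G := g.toBasedFunctor) α).naturality (ObcHom.app k w)
    exact (square_eqToHom _ _ _ _ h2 _ _ _ _ _ _ _).trans
      (congrArg (fun t => (FibHom.app α (x.val.obj w) ≫ eqToHom _) ≫ t ≫ eqToHom _) h1.symm)
  isHomLift' x := IsHomLift.map (obcProj c G) (vert (FibHom.whiskerLeft x.val α) :
    (⟨x.base, x.val.comp f⟩ : ObcObj c G) ⟶ ⟨x.base, x.val.comp g⟩)

theorem obcMap₂_app_app (c : Cleavage p) {F : FibCat.{v, u} B} {G : FibCat.{v₃, u₃} B}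
    {f g : FibHom F G} (α : f ⟶ g) (x : ObcObj c F) (w : Over x.base) :
    ObcHom.app (FibHom.app (obcMap₂ c α) x) w =
      FibHom.app α (x.val.obj w) ≫ eqToHom (congrArg (x.val.comp g).obj (over_map_id w).symm) :=
  vert_app _ w

theorem obcMap₂_id_app (c : Cleavage p) {F : FibCat.{v, u} B} {G : FibCat.{v₃, u₃} B}
    (f : FibHom F G) (x : ObcObj c F) :
    FibHom.app (obcMap₂ c (𝟙 f)) x = FibHom.app (𝟙 (obcMap c f)) x :=
  ObcHom.ext_app rfl fun w => (Category.comp_id _).trans ((obcMap₂_app_app c (𝟙 f) x w).trans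
    ((Category.id_comp _).trans (ObcHom.catId_app _ w).symm))

theorem comp_eqToHom_aux {C : Type u} [Category.{v} C] {X Y Z Y₂ Z₂ Z₃ Z₄ Z₅ : C}
    (s : X ⟶ Y) (t : Y ⟶ Z) (e₁ : Z = Z₂) (e₂ : Z₂ = Z₄) (e₃ : Y = Y₂) (e₄ : Y₂ = Y) (e₅ : Z = Z₃)
    (e₆ : Z₃ = Z₅) (e₇ : Z₅ = Z₄) :
    ((s ≫ t) ≫ eqToHom e₁) ≫ eqToHom e₂ =
      (s ≫ eqToHom e₃) ≫ ((eqToHom e₄ ≫ t ≫ eqToHom e₅) ≫ eqToHom e₆) ≫ eqToHom e₇ := by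
  subst e₁ e₂ e₃ e₅ e₆
  simp

theorem obcMap₂_comp_app (c : Cleavage p) {F : FibCat.{v, u} B} {G : FibCat.{v₃, u₃} B}
    {f g h : FibHom F G} (α : f ⟶ g) (β : g ⟶ h) (x : ObcObj c F) :
    FibHom.app (obcMap₂ c (α ≫ β)) x =
      FibHom.app (obcMap₂ c α) x ≫ FibHom.app (obcMap₂ c β) x := by
  refine ObcHom.ext_app (Category.id_comp (𝟙 x.base)).symm fun w => ?_
  have h1 := (obcMap₂_app_app c β x ((Over.map (𝟙 x.base)).obj w)).trans
    (congrArg (· ≫ eqToHom (congrArg (x.val.comp h).obj (over_map_id _).symm))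
      (FibHom.app_eq β (congrArg x.val.obj (over_map_id w))))
  rw [ObcHom.catComp_app, obcMap₂_app_app, obcMap₂_app_app]
  refine Eq.trans ?_ (congrArg (fun t => (FibHom.app α (x.val.obj w) ≫ eqToHom _) ≫ t ≫ eqToHom _)
    h1.symm)
  exact comp_eqToHom_aux _ _ _ _ _ _ _ _ _

theorem obcMap₂_whiskerRight_app (c : Cleavage p) {F : FibCat.{v, u} B} {G : FibCat.{v₃, u₃} B}
    {H : FibCat.{v₄, u₄} B} {f g : FibHom F G} (α : f ⟶ g) (h : FibHom G H) (x : ObcObj c F) :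
    FibHom.app (obcMap₂ c (FibHom.whiskerRight α h)) x =
      FibHom.app (FibHom.whiskerRight (obcMap₂ c α) (obcMap c h)) x := by
  refine ObcHom.ext_app rfl fun w => (Category.comp_id _).trans ((obcMap₂_app_app c _ x w).trans ?_)
  have h1 := congrArg h.map (obcMap₂_app_app c α x w)
  refine Eq.trans ?_ h1.symm
  exact ((h.map_comp _ _).trans (congrArg (h.map (FibHom.app α (x.val.obj w)) ≫ ·)
    (eqToHom_map h.toFunctor _))).symm

/-- Evaluation of the objects of the oplax base change at `⟨a, 𝟙 a⟩`. On an arrow `k` over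
`a ⟶ a'` it is the component of `k` at `⟨a, 𝟙 a⟩`, followed by the action of the codomain of `k`
on the canonical arrow `⟨a, a ⟶ a'⟩ ⟶ ⟨a', 𝟙 a'⟩` of `A / a'`. -/
abbrev obcEvalFunctor (c : Cleavage p) (F : FibCat.{v, u} B) : ObcObj c F ⥤ F.obj where
  obj x := x.val.obj (Over.mk (𝟙 x.base))
  map {x y} k := ObcHom.app k (Over.mk (𝟙 x.base)) ≫
    y.val.map (Over.homMk (ObcHom.base k) (by simp) :
      (Over.map (ObcHom.base k)).obj (Over.mk (𝟙 x.base)) ⟶ Over.mk (𝟙 y.base))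
  map_id x := by
    rw [ObcHom.catId_app, ← eqToHom_map x.val.toFunctor (over_map_id _).symm]
    refine (x.val.map_comp _ _).symm.trans ?_
    refine (congrArg x.val.map ?_).trans (x.val.map_id _)
    ext
    exact (Category.comp_id _).trans (Over.eqToHom_left _)
  map_comp {x y z} k l := by
    have h := ObcHom.naturality l (Over.homMk (ObcHom.base k) (by simp) :
      (Over.map (ObcHom.base k)).obj (Over.mk (𝟙 x.base)) ⟶ Over.mk (𝟙 y.base))
    simp only [Category.assoc]
    rw [reassoc_of% h, ObcHom.catComp_app, ← eqToHom_map z.val.toFunctor (over_map_comp _ _ _).symm]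
    simp only [Category.assoc]
    congr 2
    refine (z.val.map_comp _ _).symm.trans (Eq.trans (congrArg z.val.map ?_) (z.val.map_comp _ _))
    ext
    refine (congrArg (· ≫ _) (Over.eqToHom_left _)).trans ?_
    exact Category.id_comp _

/-- Evaluation of the objects of the oplax base change at `⟨a, 𝟙 a⟩`, as a fibred functor. -/
abbrev obcEval (c : Cleavage p) (F : FibCat.{v, u} B) : FibHom (sumObj c (obcObj c F)) F where
  toFunctor := obcEvalFunctor c F
  w := by
    refine CategoryTheory.Functor.ext (F := obcEvalFunctor c F ⋙ F.p) (G := obcProj c F ⋙ p)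
      (fun x => x.val.w_obj (Over.mk (𝟙 x.base))) fun x y k => ?_
    have h1 : F.p.IsHomLift (𝟙 (p.obj x.base)) (ObcHom.app k (Over.mk (𝟙 x.base))) :=
      BasedNatTrans.isHomLift (F := x.val.toBasedFunctor)
        (G := ((sumMap c (yoMap (ObcHom.base k))).comp y.val).toBasedFunctor) (ObcHom.cell k)
        (a := (Over.mk (𝟙 x.base) : Over x.base)) rfl
    let m : (Over.map (ObcHom.base k)).obj (Over.mk (𝟙 x.base)) ⟶ Over.mk (𝟙 y.base) :=
      Over.homMk (ObcHom.base k) (by simp)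
    have h0 : (sumObj c (yo y.base)).p.IsHomLift (p.map (ObcHom.base k)) m :=
      IsHomLift.map (Over.forget y.base ⋙ p) m
    have h2 : F.p.IsHomLift (p.map (ObcHom.base k)) (y.val.map m) :=
      BasedFunctor.preserves_isHomLift y.val.toBasedFunctor (p.map (ObcHom.base k)) m
    have h3 : F.p.IsHomLift (p.map (ObcHom.base k))
        (ObcHom.app k (Over.mk (𝟙 x.base)) ≫ y.val.map m) :=
      IsHomLift.comp_lift_id_left' F.p (p.obj x.base) (ObcHom.app k (Over.mk (𝟙 x.base)))
        (p.map (ObcHom.base k)) (y.val.map m)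
    exact IsHomLift.fac' F.p (p.map (ObcHom.base k))
      (ObcHom.app k (Over.mk (𝟙 x.base)) ≫ y.val.map m)
  preserves φ hφ := by
    refine ((obcCleavage F).comp c).preserves F.p (obcEvalFunctor c F) (fun {b} x k => ?_) φ hφ
    refine (congrArg (fun q => IsCart F.p q) (Category.id_comp _)).mpr ?_
    refine x.val.preserves _ (isCart_comp_functor _ _ (isCart_over _) ?_)
    have h2 := c.cart x.base k
    exact isCart_of_lift _ _ _ (h := h2)

/-- The transposition functor `φ ↦ φ♯`. A fibred functor `φ : E ⟶ Δ F` is sent to the fibred functor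
`e ↦ φ(e) ⟨a, 𝟙 a⟩`, for `e` over `a`, and a 2-cell `θ` to the 2-cell with components
`θ(e) ⟨a, 𝟙 a⟩`; the explicit formulas are in the three lemmas below. -/
abbrev transpose (c : Cleavage p) (E : FibCat.{v₃, u₃} A) (F : FibCat.{v, u} B) :
    FibHom E (obcObj c F) ⥤ FibHom (sumObj c E) F where
  obj φ := (sumMap c φ).comp (obcEval c F)
  map θ := FibHom.whiskerRight (sumMap₂ c θ) (obcEval c F)
  map_id _ := FibHom.hom_ext fun _ => (obcEval c F).map_id _
  map_comp _ _ := FibHom.hom_ext fun _ => (obcEval c F).map_comp _ _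

theorem transpose_obj_obj (c : Cleavage p) (E : FibCat.{v₃, u₃} A) (F : FibCat.{v, u} B)
    (φ : FibHom E (obcObj c F)) (e : E.obj) :
    ((transpose c E F).obj φ).obj e = (φ.obj e).val.obj (Over.mk (𝟙 (φ.obj e).base)) := rfl

theorem transpose_obj_map (c : Cleavage p) (E : FibCat.{v₃, u₃} A) (F : FibCat.{v, u} B)
    (φ : FibHom E (obcObj c F)) {e e' : E.obj} (k : e ⟶ e') :
    ((transpose c E F).obj φ).map k =
      ObcHom.app (φ.map k) (Over.mk (𝟙 (φ.obj e).base)) ≫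
        (φ.obj e').val.map (Over.homMk (ObcHom.base (φ.map k)) (by simp) :
          (Over.map (ObcHom.base (φ.map k))).obj (Over.mk (𝟙 (φ.obj e).base)) ⟶
            Over.mk (𝟙 (φ.obj e').base)) := rfl

theorem transpose_map_app (c : Cleavage p) (E : FibCat.{v₃, u₃} A) (F : FibCat.{v, u} B)
    {φ ψ : FibHom E (obcObj c F)} (θ : φ ⟶ ψ) (e : E.obj) :
    FibHom.app ((transpose c E F).map θ) e =
      ObcHom.app (FibHom.app θ e) (Over.mk (𝟙 (φ.obj e).base)) ≫
        (ψ.obj e).val.map (Over.homMk (ObcHom.base (FibHom.app θ e)) (by simp) :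
          (Over.map (ObcHom.base (FibHom.app θ e))).obj (Over.mk (𝟙 (φ.obj e).base)) ⟶
            Over.mk (𝟙 (ψ.obj e).base)) := rfl

/-- The comparison of the category of fibred functors from the oplax sum of `y a` to `F` with the
fibre of the oplax base change of `F` over `a`. -/
def obcFibre (c : Cleavage p) (F : FibCat.{v, u} B) (a : A) :
    FibHom (sumObj c (yo a)) F ⥤ (obcObj c F).p.Fiber a where
  obj e := ⟨⟨a, e⟩, rfl⟩
  map {e e'} t := ⟨vert t, IsHomLift.map (obcProj c F) (vert t : (⟨a, e⟩ : ObcObj c F) ⟶ ⟨a, e'⟩)⟩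
  map_id e := Subtype.ext (ObcHom.ext_app rfl fun w => (Category.comp_id _).trans
    ((vert_app (𝟙 e) w).trans ((Category.id_comp _).trans (ObcHom.catId_app _ w).symm)))
  map_comp {e e' e''} s t := Subtype.ext <| by
    refine ObcHom.ext_app (Category.id_comp (𝟙 a)).symm fun w => ?_
    have h1 := (vert_app t ((Over.map (𝟙 a)).obj w)).trans
      (congrArg (· ≫ eqToHom (congrArg e''.obj (over_map_id _).symm))
        (FibHom.app_eq t (over_map_id w)))
    refine (congrArg (· ≫ eqToHom _) (vert_app (s ≫ t) w)).trans (Eq.trans ?_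
      (ObcHom.catComp_app (vert s) (vert t) w).symm)
    rw [vert_app]
    refine Eq.trans ?_ (congrArg (fun t => (FibHom.app s w ≫ eqToHom _) ≫ t ≫ eqToHom _) h1.symm)
    exact comp_eqToHom_aux _ _ _ _ _ _ _ _ _

end BaseChange

section TwoFunctors

variable {A : Type u₁} [Category.{v₁} A] {B : Type u₂} [Category.{v₂} B] {p : A ⥤ B}

/-- The oplax sum 2-functor: postcomposition with the fibration `p`. -/
def oplaxSum (c : Cleavage p) : StrictPseudofunctor (FibCat.{v, u} A) (FibCat.{v, u} B) :=
  StrictPseudofunctor.mk''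
    { obj E := sumObj c E
      map f := sumMap c f
      map₂ α := sumMap₂ c α
      map₂_id _ := rfl
      map₂_comp _ _ := rfl
      map_id _ := rfl
      map_comp _ _ := rfl
      map₂_whisker_left _ _ _ _ := ((Category.id_comp _).trans (Category.comp_id _)).symm
      map₂_whisker_right _ _ := ((Category.id_comp _).trans (Category.comp_id _)).symm }

/-- The oplax base change 2-functor: `F` is sent to the fibred category whose objects over `a` are
the fibred functors from the oplax sum of `y a` to `F`. -/
def oplaxBaseChange (c : Cleavage p) :
    StrictPseudofunctor (FibCat.{max u₁ v₁ w, max u₁ v₁ w w'} B)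
      (FibCat.{max u₁ v₁ w, max u₁ v₁ w w'} A) :=
  StrictPseudofunctor.mk''
    { obj F := obcObj c F
      map f := obcMap c f
      map₂ α := obcMap₂ c α
      map₂_id f := FibHom.hom_ext fun x => obcMap₂_id_app c f x
      map₂_comp α β := FibHom.hom_ext fun x => obcMap₂_comp_app c α β x
      map_id _ := rfl
      map_comp _ _ := rfl
      map₂_whisker_left _ _ _ _ := ((Category.id_comp _).trans (Category.comp_id _)).symm
      map₂_whisker_right α h := FibHom.hom_ext fun x => (obcMap₂_whiskerRight_app c α h x).trans
        ((Category.id_comp _).trans (Category.comp_id _)).symm }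

end TwoFunctors

section PseudoAdjunction

open Bicategory

variable {C : Type u₁} [Bicategory.{w, v₁} C] {D : Type u₂} [Bicategory.{w', v₂} D]

/-- Reassociation of a five-fold composite. -/
abbrev shuffle {X'' X' X Y Y' Y'' : C} (f' : X'' ⟶ X') (f : X' ⟶ X) (φ : X ⟶ Y) (g : Y ⟶ Y')
    (g' : Y' ⟶ Y'') : (f' ≫ f) ≫ φ ≫ g ≫ g' ⟶ f' ≫ (f ≫ φ ≫ g) ≫ g' :=
  (α_ f' f _).hom ≫ f' ◁ (f ◁ (α_ φ g g').inv ≫ (α_ f (φ ≫ g) g').inv)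

/-- A pseudo-adjunction `L ⊣ R` between pseudofunctors, presented by equivalences of categories
`Hom (X, R Y) ≌ Hom (L X, Y)` that are pseudo-natural in `X` and `Y` jointly. -/
structure PseudoAdjunction (L : C ⥤ᵖ D) (R : D ⥤ᵖ C) where
  /-- The transposition functors. -/
  sharp (X : C) (Y : D) : (X ⟶ R.obj Y) ⥤ (L.obj X ⟶ Y)
  isEquivalence (X : C) (Y : D) : (sharp X Y).IsEquivalence
  /-- The invertible pseudo-naturality cell of the pair `(f, g)`, at the object `φ`. -/
  nat {X' X : C} {Y Y' : D} (f : X' ⟶ X) (g : Y ⟶ Y') (φ : X ⟶ R.obj Y) :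
    L.map f ≫ (sharp X Y).obj φ ≫ g ≅ (sharp X' Y').obj (f ≫ φ ≫ R.map g)
  /-- The pseudo-naturality cell of `(f, g)` is a natural transformation of functors. -/
  nat_natural {X' X : C} {Y Y' : D} (f : X' ⟶ X) (g : Y ⟶ Y') {φ ψ : X ⟶ R.obj Y} (θ : φ ⟶ ψ) :
    L.map f ◁ ((sharp X Y).map θ ▷ g) ≫ (nat f g ψ).hom =
      (nat f g φ).hom ≫ (sharp X' Y').map (f ◁ (θ ▷ R.map g))
  /-- The pseudo-naturality cells are natural in the 2-cells of `C` and `D`. -/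
  nat_natural₂ {X' X : C} {Y Y' : D} {f f' : X' ⟶ X} (α : f ⟶ f') {g g' : Y ⟶ Y'} (β : g ⟶ g')
      (φ : X ⟶ R.obj Y) :
    (L.map₂ α ▷ ((sharp X Y).obj φ ≫ g) ≫ L.map f' ◁ ((sharp X Y).obj φ ◁ β)) ≫
        (nat f' g' φ).hom =
      (nat f g φ).hom ≫ (sharp X' Y').map (α ▷ (φ ≫ R.map g) ≫ f' ◁ (φ ◁ R.map₂ β))
  /-- The pseudo-naturality cell of a pair of identities is the identity, up to the structural
  2-cells. -/
  nat_id (X : C) (Y : D) (φ : X ⟶ R.obj Y) :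
    (L.mapId X).hom ▷ ((sharp X Y).obj φ ≫ 𝟙 Y) ≫ (λ_ _).hom ≫ (ρ_ _).hom =
      (nat (𝟙 X) (𝟙 Y) φ).hom ≫
        (sharp X Y).map ((λ_ _).hom ≫ φ ◁ (R.mapId Y).hom ≫ (ρ_ φ).hom)
  /-- The pseudo-naturality cell of a pair of composites is the pasting of the pseudo-naturality
  cells, up to the structural 2-cells. -/
  nat_comp {X'' X' X : C} {Y Y' Y'' : D} (f' : X'' ⟶ X') (f : X' ⟶ X) (g : Y ⟶ Y') (g' : Y' ⟶ Y'')
      (φ : X ⟶ R.obj Y) :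
    (L.mapComp f' f).hom ▷ ((sharp X Y).obj φ ≫ g ≫ g') ≫
        shuffle (L.map f') (L.map f) ((sharp X Y).obj φ) g g' ≫
          L.map f' ◁ ((nat f g φ).hom ▷ g') ≫ (nat f' g' (f ≫ φ ≫ R.map g)).hom =
      (nat (f' ≫ f) (g ≫ g') φ).hom ≫
        (sharp X'' Y'').map ((f' ≫ f) ◁ φ ◁ (R.mapComp g g').hom ≫
          shuffle f' f φ (R.map g) (R.map g'))

end PseudoAdjunction

end Fibred

/-!
The fibres: the functor `obcFibre` is bijective on objects, and it is fully faithful because an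
arrow of the oplax base change over an identity is a 2-cell `e ⟶ e'` up to the strict equality
`e' ∘ Σ (y (𝟙 a)) = e'` (`obcFibre_full`, `obcFibre_faithful`). Such a functor has a strict inverse.

The equivalence: a cleavage lets every object `e` of `E` over `a` be classified by a fibred functor
`A / a ⟶ E`, which sends `k : b ⟶ a` to the domain of the chosen lift of `k` at `e`. This is
functorial in `e` and gives a fibred functor `unit : E ⟶ Δ (Σ E)`; no splitting is needed, since
all the arrows involved are arrows between chosen lifts induced by an arrow of `E` and an arrow of
the base (`Cleavage.hom`), and these compose as the inducing arrows do. The quasi-inverse of the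
transposition sends `G : Σ E ⟶ F` to `Δ G ∘ unit` (`untranspose`).

* Transposing `Δ G ∘ unit` gives `e ↦ G (e')`, with `e' ⟶ e` the chosen lift of the identity. That
  lift is invertible, and its image under `G` is the comparison with `G` (`counitHom`).
* For `φ : E ⟶ Δ F`, an object `e` and `k : b ⟶ a`, let `m : e' ⟶ e` be the chosen lift of `k`. The
  arrow `φ m` has a component `φ(e') ⟨b, 𝟙 b⟩ ⟶ φ(e) ⟨b, k⟩`, which is invertible since `φ m` is
  cartesian, and an arrow of the oplax base change is cartesian exactly if its 2-cell is invertible.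
  These components form the comparison of `Δ (φ♯) ∘ unit` with `φ` (`compareHom`).

The objects `φ(e)` lie over `a` up to a propositional equality only. The evaluation `ObcHom.ev` of
an arrow of the oplax base change takes a factorization of the underlying arrow of the base as an
argument, and so absorbs the resulting transports; naturality of the comparisons is then an instance
of the rules by which `ObcHom.ev` composes.

The pseudo-adjunction: transposition commutes strictly with pre- and postcomposition, so the
pseudo-naturality cells are transports along equalities of fibred functors. The two naturality laws
are checked on components, and in the unit and composition laws both sides are pastings of
transports (`IsStructural`), hence equal.
-/

namespace Fibred

/-! ### Transport along equalities of objects -/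

theorem comp_eqToHom_eqToHom {C : Type u₁} [Category.{v₁} C] {X Y Y₁ Y₂ : C} (t : X ⟶ Y)
    (h₁ : Y = Y₁) (h₂ : Y₁ = Y₂) (h₃ : Y₂ = Y) :
    ((t ≫ eqToHom h₁) ≫ eqToHom h₂) ≫ eqToHom h₃ = t := by
  subst h₁ h₂; simp

theorem eqToHom_comp_eqToHom {C : Type u₃} [Category.{v₃} C] {X Y Z W : C} (h₁ : X = Y)
    (h₂ : Y = Z) (h₃ : Z = W) (h₄ : X = W) :
    (eqToHom h₁ ≫ eqToHom h₂) ≫ eqToHom h₃ = eqToHom h₄ := by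
  subst h₁ h₂ h₃; simp

theorem eqToHom_id_eqToHom {C : Type u₃} [Category.{v₃} C] {X Y Z Y' W : C} (h₁ : X = Y)
    (h₂ : Y = Z) (h₃ : Z = Y') (h₄ : Y' = W) (h₅ : X = W) :
    eqToHom h₁ ≫ (eqToHom h₂ ≫ 𝟙 Z ≫ eqToHom h₃) ≫ eqToHom h₄ = eqToHom h₅ := by
  subst h₁ h₂ h₃ h₄; simp

/-- Commutation of a square of arrows whose vertices agree up to equality only. -/
theorem square_eqToHom_aux {C : Type u₃} [Category.{v₃} C] {X Y Y' Z Z₁ Z₂ W : C}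
    (r : X ⟶ Y) (s : Y ⟶ Z) (s' : X ⟶ Y') (t' : Y' ⟶ W) (e₁ : Z = Z₁) (e₂ : Z₁ = Z₂) (e₃ : W = Z₂)
    (h : (r ≫ s) ≫ eqToHom (e₁.trans (e₂.trans e₃.symm)) = s' ≫ t') :
    (r ≫ s ≫ eqToHom e₁) ≫ eqToHom e₂ = s' ≫ t' ≫ eqToHom e₃ := by
  subst e₁ e₂ e₃
  simpa using h

/-- The variant of `square_eqToHom_aux` with the second arrow transported on both sides. -/
theorem square_eqToHom_aux' {C : Type u₃} [Category.{v₃} C] {X Y Y₁ Y' Z Z₁ Z₂ Z₃ W : C}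
    (r : X ⟶ Y) (s : Y ⟶ Z) (s' : X ⟶ Y') (t' : Y' ⟶ W) (e₀ : Y = Y₁) (e₀' : Y₁ = Y)
    (e : Z = Z₁) (e₁ : Z₁ = Z₂) (e₂ : Z₂ = Z₃) (e₃ : W = Z₃)
    (h : (r ≫ s) ≫ eqToHom (e.trans (e₁.trans (e₂.trans e₃.symm))) = s' ≫ t') :
    ((r ≫ eqToHom e₀) ≫ (eqToHom e₀' ≫ s ≫ eqToHom e) ≫ eqToHom e₁) ≫ eqToHom e₂ =
      s' ≫ t' ≫ eqToHom e₃ := by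
  subst e₀ e e₁ e₂ e₃
  simpa using h

theorem comp_id_eq_id_comp {C : Type u₁} [Category.{v₁} C] {X Y : C} {s t : X ⟶ Y}
    {i : X ⟶ X} {j : Y ⟶ Y} (hj : j = 𝟙 Y) (hi : i = 𝟙 X) : s ≫ j = i ≫ t ↔ s = t := by
  rw [hj, hi, Category.comp_id, Category.id_comp]

theorem isHomLift_id_of_eqToHom {X : Type u₃} [Category.{v₃} X] {B : Type u₁} [Category.{v₁} B]
    {q : X ⥤ B} {b b' : B} (h : b = b') {x y : X} {f : x ⟶ y}
    (hf : q.IsHomLift (eqToHom h) f) : q.IsHomLift (𝟙 b') f := by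
  subst h; exact hf

/-! ### Isomorphisms -/

/-- A fully faithful functor that is bijective on objects is an isomorphism of categories. -/
theorem exists_strict_inverse {C : Type u₁} [Category.{v₁} C] {D : Type u₂} [Category.{v₂} D]
    (F : C ⥤ D) [F.Full] [F.Faithful] (hF : Function.Bijective F.obj) :
    ∃ G : D ⥤ C, F ⋙ G = 𝟭 C ∧ G ⋙ F = 𝟭 D := by
  obtain ⟨g, hgF, hFg⟩ := Function.bijective_iff_has_inverse.1 hF
  refine ⟨{ obj := g
            map := fun {d d'} k => F.preimage (eqToHom (hFg d) ≫ k ≫ eqToHom (hFg d').symm)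
            map_id := fun d => F.map_injective (by simp)
            map_comp := fun k l => F.map_injective (by simp) }, ?_, ?_⟩
  · refine CategoryTheory.Functor.ext hgF fun x y k => F.map_injective ?_
    simp [eqToHom_map]
  · exact CategoryTheory.Functor.ext hFg fun x y k => by simp

/-- A cartesian arrow over an isomorphism is an isomorphism. -/
theorem isIso_of_isCart {X : Type u₂} [Category.{v₂} X] {B : Type u₁} [Category.{v₁} B]
    (p : X ⥤ B) {x y : X} (φ : x ⟶ y) (hφ : IsCart p φ) (h : IsIso (p.map φ)) : IsIso φ :=
  Functor.IsStronglyCartesian.isIso_of_base_isIso p (p.map φ) φ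

theorem FibHom.isIso_of_app {B : Type u₁} [Category.{v₁} B] {X : FibCat.{v₂, u₂} B}
    {Y : FibCat.{v₃, u₃} B} {F G : FibHom X Y} (α : F ⟶ G) (h : ∀ x, IsIso (FibHom.app α x)) :
    IsIso α := by
  let β : BasedNatTrans F.toBasedFunctor G.toBasedFunctor := α
  have h' : ∀ x, IsIso (β.toNatTrans.app x) := h
  have : IsIso (X := F.toFunctor) β.toNatTrans :=
    NatIso.isIso_of_isIso_app (F := F.toFunctor) (G := G.toFunctor) β.toNatTrans
  obtain ⟨γ, h1, h2⟩ := BasedNatIso.isIso_of_toNatTrans_isIso β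
  exact ⟨γ, h1, h2⟩

theorem FibHom.isIso_app {B : Type u₁} [Category.{v₁} B] {X : FibCat.{v₂, u₂} B}
    {Y : FibCat.{v₃, u₃} B} {F G : FibHom X Y} (α : F ⟶ G) [IsIso α] (x : X.obj) :
    IsIso (FibHom.app α x) :=
  ⟨FibHom.app (inv α) x, by rw [← FibHom.comp_app, IsIso.hom_inv_id, FibHom.id_app],
    by rw [← FibHom.comp_app, IsIso.inv_hom_id, FibHom.id_app]⟩

/-! ### The fibres of the oplax base change -/

section

variable {A : Type u₁} [Category.{v₁} A] {B : Type u₂} [Category.{v₂} B] {p : A ⥤ B}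

/-- Extensionality for arrows of the oplax base change in terms of their 2-cells rather than the
components of these. -/
theorem ObcHom.mk_eq_mk {c : Cleavage p} {F : FibCat.{v, u} B} {x y : ObcObj c F}
    {k l : x.base ⟶ y.base} (h : k = l) {t : x.val ⟶ (sumMap c (yoMap k)).comp y.val}
    {s : x.val ⟶ (sumMap c (yoMap l)).comp y.val} (hts : t ≫ eqToHom (by rw [h]) = s) :
    (⟨k, t⟩ : ObcHom c x y) = ⟨l, s⟩ := by
  subst h hts; simp

theorem obcFibre_full (c : Cleavage p) (F : FibCat.{v, u} B) (a : A) : (obcFibre c F a).Full where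
  map_surjective {e e'} := by
    rintro ⟨⟨k, t⟩, hk⟩
    have h : 𝟙 a = k := @IsHomLift.eq_of_isHomLift _ _ _ _ (obcProj c F) (⟨a, e⟩ : ObcObj c F)
      ⟨a, e'⟩ (𝟙 a) (⟨k, t⟩ : ObcHom c _ _) hk
    subst h
    refine ⟨(t : e ⟶ _) ≫ eqToHom (sum_yo_id c e'), Subtype.ext ?_⟩
    exact ObcHom.mk_eq_mk rfl (comp_eqToHom_eqToHom t _ _ _)

theorem obcFibre_faithful (c : Cleavage p) (F : FibCat.{v, u} B) (a : A) :
    (obcFibre c F a).Faithful where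
  map_injective {e e'} s t h := by
    have h1 : vert s = vert t := congrArg Subtype.val h
    have h2 : s ≫ eqToHom (sum_yo_id c e').symm = t ≫ eqToHom (sum_yo_id c e').symm := by
      injection h1
    exact (cancel_mono _).1 h2

theorem obcFibre_bijective (c : Cleavage p) (F : FibCat.{v, u} B) (a : A) :
    Function.Bijective (obcFibre c F a).obj := by
  constructor
  · intro e e' h
    have h1 : (⟨a, e⟩ : ObcObj c F) = ⟨a, e'⟩ := congrArg Subtype.val h
    injection h1
  · rintro ⟨⟨b, e⟩, rfl⟩
    exact ⟨e, rfl⟩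

theorem exists_inverse_obcFibre (c : Cleavage p) (F : FibCat.{v, u} B) (a : A) :
    ∃ G : (obcObj c F).p.Fiber a ⥤ FibHom (sumObj c (yo a)) F,
      obcFibre c F a ⋙ G = 𝟭 (FibHom (sumObj c (yo a)) F) ∧
        G ⋙ obcFibre c F a = 𝟭 ((obcObj c F).p.Fiber a) :=
  have := obcFibre_full c F a
  have := obcFibre_faithful c F a
  exists_strict_inverse _ (obcFibre_bijective c F a)

end

/-! ### Cartesian and invertible arrows of the oplax base change -/

section

variable {A : Type u₁} [Category.{v₁} A] {B : Type u₂} [Category.{v₂} B] {p : A ⥤ B}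
  {c : Cleavage p} {F : FibCat.{v, u} B}

theorem isIso_vert {a : A} {e e' : FibHom (sumObj c (yo a)) F} (t : e ⟶ e') [IsIso t] :
    IsIso (vert t : (⟨a, e⟩ : ObcObj c F) ⟶ ⟨a, e'⟩) :=
  inferInstanceAs (IsIso ((obcFibre c F a ⋙ Functor.Fiber.fiberInclusion).map t))

theorem isCart_obcLift {a : A} (x : ObcObj c F) (k : a ⟶ x.base) :
    IsCart (obcProj c F) (obcLift x k) :=
  isCart_of_lift _ _ _ (h := (obcCleavage F).cart x k)

/-- Every arrow of the oplax base change is a vertical arrow followed by a chosen lift. -/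
theorem vert_comp_obcLift {x y : ObcObj c F} (f : x ⟶ y) :
    (vert (ObcHom.cell f) : x ⟶ ⟨x.base, _⟩) ≫ obcLift y (ObcHom.base f) = f := by
  rw [comp_obcLift]
  exact ObcHom.mk_eq_mk (Category.id_comp (ObcHom.base f)) (comp_eqToHom_eqToHom _ _ _ _)

theorem isCart_of_isIso_cell {x y : ObcObj c F} (f : x ⟶ y) (hf : IsIso (ObcHom.cell f)) :
    IsCart (obcProj c F) f := by
  rw [← vert_comp_obcLift f]
  have := isIso_vert (c := c) (ObcHom.cell f)
  exact isCart_comp _ (isCart_of_isIso _ _) (isCart_obcLift _ _)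

theorem isIso_of_isIso_cell {x y : ObcObj c F} (f : x ⟶ y) (h : IsIso (ObcHom.base f))
    (hf : IsIso (ObcHom.cell f)) : IsIso f :=
  isIso_of_isCart (obcProj c F) f (isCart_of_isIso_cell f hf) h

end

/-! ### Arrows between chosen lifts -/

section

variable {X : Type u₂} [Category.{v₂} X] {A : Type u₁} [Category.{v₁} A] {q : X ⥤ A}

/-- The arrow over `g` between chosen lifts induced by an arrow `m`. The equation `h` says that the
image of `m` closes the square formed by `f`, `f'` and `g` in the base. -/
noncomputable def Cleavage.hom (c : Cleavage q) {b b' : A} {x y : X} (f : b ⟶ q.obj x)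
    (f' : b' ⟶ q.obj y) (g : b ⟶ b') (m : x ⟶ y) (h : f ≫ q.map m = g ≫ f') :
    c.obj x f ⟶ c.obj y f' :=
  have := c.cart x f
  have := c.cart y f'
  Functor.IsStronglyCartesian.map q f' (c.map y f') h (c.map x f ≫ m)

section

variable (c : Cleavage q) {b b' : A} {x y : X} (f : b ⟶ q.obj x)
    (f' : b' ⟶ q.obj y) (g : b ⟶ b') (m : x ⟶ y) (h : f ≫ q.map m = g ≫ f')

theorem Cleavage.isHomLift_hom : q.IsHomLift g (c.hom f f' g m h) := by
  have := c.cart x f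
  have := c.cart y f'
  exact Functor.IsStronglyCartesian.map_isHomLift q f' (c.map y f') h (c.map x f ≫ m)

theorem Cleavage.hom_map : c.hom f f' g m h ≫ c.map y f' = c.map x f ≫ m := by
  have := c.cart x f
  have := c.cart y f'
  exact Functor.IsStronglyCartesian.fac q f' (c.map y f') h (c.map x f ≫ m)

theorem Cleavage.eq_hom (χ : c.obj x f ⟶ c.obj y f') (hχ : q.IsHomLift g χ)
    (hm : χ ≫ c.map y f' = c.map x f ≫ m) : χ = c.hom f f' g m h := by
  have := c.cart x f
  have := c.cart y f'
  exact Functor.IsStronglyCartesian.map_uniq q f' (c.map y f') h (c.map x f ≫ m) χ hm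

theorem Cleavage.isCart_map : IsCart q (c.map x f) :=
  isCart_of_lift _ _ _ (h := c.cart x f)

theorem Cleavage.obj_obj : q.obj (c.obj x f) = b := by
  have := c.cart x f
  exact IsHomLift.domain_eq q f (c.map x f)

theorem Cleavage.map_map : q.map (c.map x f) = eqToHom (c.obj_obj f) ≫ f := by
  have := c.cart x f
  exact (IsHomLift.fac' q f (c.map x f)).trans (by simp)

theorem Cleavage.map_hom : q.map (c.hom f f' g m h) =
    eqToHom (c.obj_obj f) ≫ g ≫ eqToHom (c.obj_obj f').symm :=
  have := c.isHomLift_hom f f' g m h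
  IsHomLift.fac' q g (c.hom f f' g m h)

theorem Cleavage.isCart_hom (hm : IsCart q m) : IsCart q (c.hom f f' g m h) := by
  refine isCart_of_comp q (c.isCart_map f') ?_
  rw [c.hom_map]
  exact isCart_comp q (c.isCart_map f) hm

theorem Cleavage.isIso_hom (hm : IsCart q m) (hg : IsIso g) : IsIso (c.hom f f' g m h) := by
  have := c.isHomLift_hom f f' g m h
  refine isIso_of_isCart q _ (c.isCart_hom f f' g m h hm) ?_
  rw [IsHomLift.fac' q g (c.hom f f' g m h)]
  infer_instance

end

theorem Cleavage.hom_comp_hom (c : Cleavage q) {b b' b'' : A} {x y z : X} (f : b ⟶ q.obj x)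
    (f' : b' ⟶ q.obj y) (f'' : b'' ⟶ q.obj z) (g : b ⟶ b') (g' : b' ⟶ b'') (m : x ⟶ y)
    (m' : y ⟶ z) (h : f ≫ q.map m = g ≫ f') (h' : f' ≫ q.map m' = g' ≫ f'') :
    c.hom f f' g m h ≫ c.hom f' f'' g' m' h' =
      c.hom f f'' (g ≫ g') (m ≫ m') (by rw [q.map_comp, reassoc_of% h, h', Category.assoc]) := by
  have := c.isHomLift_hom f f' g m h
  have := c.isHomLift_hom f' f'' g' m' h'
  refine c.eq_hom _ _ _ _ _ _ inferInstance ?_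
  rw [Category.assoc, c.hom_map, ← Category.assoc, c.hom_map, Category.assoc]

theorem Cleavage.hom_self (c : Cleavage q) {b : A} {x : X} (f : b ⟶ q.obj x)
    (h : f ≫ q.map (𝟙 x) = 𝟙 b ≫ f) : c.hom f f (𝟙 b) (𝟙 x) h = 𝟙 _ := by
  have h1 := c.cart x f
  have h2 := IsHomLift.domain_eq q f (c.map x f)
  exact (c.eq_hom _ _ _ _ _ _ (IsHomLift.id h2) (by simp)).symm

theorem Cleavage.eqToHom_eq_hom (c : Cleavage q) {b : A} {x : X} {f f' : b ⟶ q.obj x}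
    (h : f = f') (h' : c.obj x f = c.obj x f') :
    eqToHom h' = c.hom f f' (𝟙 b) (𝟙 x) (by simp [h]) := by
  subst h
  exact (c.hom_self f _).symm

theorem Cleavage.hom_congr (c : Cleavage q) {b b' : A} {x y : X} {f : b ⟶ q.obj x}
    {f' : b' ⟶ q.obj y} {g g' : b ⟶ b'} {m m' : x ⟶ y} {h : f ≫ q.map m = g ≫ f'}
    {h' : f ≫ q.map m' = g' ≫ f'} (hg : g = g') (hm : m = m') :
    c.hom f f' g m h = c.hom f f' g' m' h' := by
  subst hg hm; rfl

end

/-! ### The unit -/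

section

variable {A : Type u₁} [Category.{v₁} A]

/-- The structure arrow of an object of `A / a`, with codomain `a` on the nose. -/
abbrev overArrow {a : A} (w : Over a) : w.left ⟶ a := w.hom

theorem overArrow_comp {a : A} {w w' : Over a} (h : w ⟶ w') :
    h.left ≫ overArrow w' = overArrow w := Over.w h

/-- The fibred functor `A / a ⟶ E` that classifies an object `e` of `E` over `a`: an arrow
`k : b ⟶ a` is sent to the domain of the chosen lift of `k` at `e`. -/
noncomputable abbrev classify (E : FibCat.{v, u} A) (e : E.obj) : FibHom (yo (E.p.obj e)) E where
  obj w := E.cleavage.obj e (overArrow w)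
  map {w w'} h := E.cleavage.hom (overArrow w)
    (overArrow w') h.left (𝟙 e) (by simp)
  map_id w := E.cleavage.hom_self _ _
  map_comp h k := by
    rw [E.cleavage.hom_comp_hom]
    exact E.cleavage.hom_congr rfl (Category.comp_id _).symm
  w := by
    refine CategoryTheory.Functor.ext (fun w => ?_) fun w w' h => ?_
    · exact E.cleavage.obj_obj (overArrow w)
    · have := E.cleavage.isHomLift_hom (overArrow w)
        (overArrow w') h.left (𝟙 e) (by simp)
      exact IsHomLift.fac' E.p h.left _
  preserves h _ := E.cleavage.isCart_hom _ _ _ _ _ (isCart_of_isIso _ _)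

/-- The action of `classify` on an arrow `m` of `E`: the component at `w` is the arrow over an
identity between the chosen lifts of `w` and of its composite with the image of `m`. -/
noncomputable def classifyMap (E : FibCat.{v, u} A) {e e' : E.obj} (m : e ⟶ e') :
    classify E e ⟶ (yoMap (E.p.map m)).comp (classify E e') where
  app w := E.cleavage.hom (overArrow w)
    (overArrow w ≫ E.p.map m) (𝟙 w.left) m (Category.id_comp _).symm
  naturality w w' h := by
    refine (E.cleavage.hom_comp_hom _ _ _ _ _ _ _ (by simp) _).trans
      (Eq.trans ?_ (E.cleavage.hom_comp_hom _ _ _ _ _ _ _ _ (by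
        rw [E.p.map_id, Category.comp_id]
        exact (overArrow_comp ((Over.map (E.p.map m)).map h)).symm)).symm)
    exact E.cleavage.hom_congr ((Category.comp_id _).trans (Category.id_comp _).symm)
      ((Category.id_comp _).trans (Category.comp_id _).symm)
  isHomLift' w := E.cleavage.isHomLift_hom _ _ _ _ _

variable {B : Type u₂} [Category.{v₂} B] {p : A ⥤ B} (c : Cleavage p)

/-- The arrow of the oplax base change of the oplax sum of `E` that classifies `m`. -/
noncomputable abbrev unitMap (E : FibCat.{v, u} A) {e e' : E.obj} (m : e ⟶ e') :
    (⟨E.p.obj e, sumMap c (classify E e)⟩ : ObcObj c (sumObj c E)) ⟶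
      ⟨E.p.obj e', sumMap c (classify E e')⟩ :=
  (⟨E.p.map m, sumMap₂ c (classifyMap E m)⟩ : ObcHom c _ _)

theorem unitMap_app (E : FibCat.{v, u} A) {e e' : E.obj} (m : e ⟶ e')
    (w : Over (E.p.obj e)) : ObcHom.app (unitMap c E m) w =
      E.cleavage.hom (overArrow w)
        (overArrow w ≫ E.p.map m) (𝟙 w.left) m
          (Category.id_comp _).symm := rfl

/-- The unit of the pseudo-adjunction: `e` over `a` is sent to the fibred functor on the oplax sum
of `y a` that classifies `e`. -/
noncomputable abbrev unit (E : FibCat.{v, u} A) : FibHom E (obcObj c (sumObj c E)) where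
  obj e := ⟨E.p.obj e, sumMap c (classify E e)⟩
  map m := unitMap c E m
  map_id e := by
    refine ObcHom.ext_app (E.p.map_id e) fun w => ?_
    rw [ObcHom.catId_app]
    erw [unitMap_app]
    refine (congrArg (_ ≫ ·) (E.cleavage.eqToHom_eq_hom ?_ _)).trans
      ((E.cleavage.hom_comp_hom _ _ _ _ _ _ _ _ _).trans (Eq.trans ?_
      (E.cleavage.eqToHom_eq_hom ?_ _).symm))
    · exact congrArg (overArrow w ≫ ·) (E.p.map_id e)
    · exact E.cleavage.hom_congr (Category.comp_id _) (Category.comp_id _)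
    · exact (Category.comp_id _).symm
  map_comp {e e' e''} m m' := by
    refine ObcHom.ext_app (E.p.map_comp m m') fun w => ?_
    rw [ObcHom.catComp_app]
    erw [unitMap_app, unitMap_app, unitMap_app]
    refine (congrArg (_ ≫ ·) (E.cleavage.eqToHom_eq_hom ?_ _)).trans
      ((E.cleavage.hom_comp_hom _ _ _ _ _ _ _ _ _).trans (Eq.trans ?_
      (congrArg (fun t => _ ≫ _ ≫ t) (E.cleavage.eqToHom_eq_hom ?_ _).symm)))
    · exact congrArg (overArrow w ≫ ·) (E.p.map_comp m m')
    · erw [E.cleavage.hom_comp_hom, E.cleavage.hom_comp_hom]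
      exact E.cleavage.hom_congr (by simp) (by simp)
    · exact Category.assoc _ _ _
  w := rfl
  preserves {e e'} m hm := by
    refine isCart_of_isIso_cell (unitMap c E m) (FibHom.isIso_of_app _ fun w => ?_)
    exact E.cleavage.isIso_hom (overArrow w) (overArrow w ≫ E.p.map m) (𝟙 w.left) m
      (Category.id_comp _).symm hm inferInstance

end

/-! ### Evaluation of arrows of the oplax base change at an arrow of the base -/

section

variable {A : Type u₁} [Category.{v₁} A] {B : Type u₂} [Category.{v₂} B] {p : A ⥤ B}
  {c : Cleavage p} {F : FibCat.{v, u} B}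

namespace ObcHom

/-- The evaluation of an arrow `f : x ⟶ y` of the oplax base change, whose image in the base is
factored as `l` followed by the object `w` of `A / y.base`: the component of `f` at `𝟙 x.base`,
followed by the action of `y` on the arrow `l` of `A / y.base` from the image of `f` to `w`. With
`w` an identity this is the action of `obcEval` on `f`. -/
def ev {x y : ObcObj c F} (f : x ⟶ y) (w : Over y.base) (l : x.base ⟶ w.left)
    (h : l ≫ w.hom = ObcHom.base f) : x.val.obj (Over.mk (𝟙 x.base)) ⟶ y.val.obj w :=
  ObcHom.app f (Over.mk (𝟙 x.base)) ≫
    y.val.map (Over.homMk l (h.trans (Category.id_comp (ObcHom.base f)).symm) :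
      (Over.map (ObcHom.base f)).obj (Over.mk (𝟙 x.base)) ⟶ w)

theorem ev_congr {x y : ObcObj c F} {f g : x ⟶ y} {w : Over y.base} {l k : x.base ⟶ w.left}
    {h : l ≫ w.hom = ObcHom.base f} {h' : k ≫ w.hom = ObcHom.base g} (hf : f = g) (hl : l = k) :
    ev f w l h = ev g w k h' := by
  subst hf hl; rfl

theorem obcEval_map {x y : ObcObj c F} (f : x ⟶ y) :
    (obcEval c F).map f = ev f (Over.mk (𝟙 y.base)) (ObcHom.base f)
      (Category.comp_id (ObcHom.base f)) := rfl

theorem ev_map {x y : ObcObj c F} (f : x ⟶ y) {w w' : Over y.base} (l : x.base ⟶ w.left)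
    (h : l ≫ w.hom = ObcHom.base f) (k : w ⟶ w') :
    ev f w l h ≫ y.val.map k = ev f w' (l ≫ k.left) (by simpa using h) := by
  refine (Category.assoc _ _ _).trans (congrArg (ObcHom.app f _ ≫ ·) ?_)
  exact (y.val.map_comp _ _).symm.trans (congrArg y.val.map (by ext; rfl))

theorem ev_eqToHom {x y : ObcObj c F} (f : x ⟶ y) {w w' : Over y.base} (l : x.base ⟶ w.left)
    (h : l ≫ w.hom = ObcHom.base f) (e : w = w') (e' : y.val.obj w = y.val.obj w') :
    ev f w l h ≫ eqToHom e' = ev f w' (l ≫ eqToHom (by rw [e])) (by subst e; simpa using h) := by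
  subst e
  simp only [eqToHom_refl, Category.comp_id]

/-- Evaluation at `w` followed by a component of a further arrow. -/
theorem ev_app {x y z : ObcObj c F} (f : x ⟶ y) (g : y ⟶ z) (w : Over y.base)
    (l : x.base ⟶ w.left) (h : l ≫ w.hom = ObcHom.base f) :
    ev f w l h ≫ ObcHom.app g w =
      ev (f ≫ g) ((Over.map (ObcHom.base g)).obj w) l
        ((Category.assoc _ _ _).symm.trans (congrArg (· ≫ ObcHom.base g) h)) := by
  unfold ev
  rw [ObcHom.catComp_app, ← eqToHom_map z.val.toFunctor (over_map_comp _ _ _).symm]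
  simp only [Category.assoc]
  rw [ObcHom.naturality]
  refine congrArg (fun t => _ ≫ _ ≫ t) ?_
  refine Eq.trans (congrArg z.val.map ?_) (z.val.map_comp _ _)
  ext
  refine Eq.trans ?_ (congrArg (· ≫ _) (Over.eqToHom_left _)).symm
  exact (Category.id_comp _).symm

/-- Evaluation of a composite: the first arrow contributes its value under `obcEval`. -/
theorem ev_comp {x y z : ObcObj c F} (f : x ⟶ y) (g : y ⟶ z) (w : Over z.base)
    (l : y.base ⟶ w.left) (h : l ≫ w.hom = ObcHom.base g) :
    (obcEval c F).map f ≫ ev g w l h =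
      ev (f ≫ g) w (ObcHom.base f ≫ l)
        ((Category.assoc _ _ _).trans (congrArg (ObcHom.base f ≫ ·) h)) := by
  rw [obcEval_map]
  refine (Category.assoc _ _ _).symm.trans ?_
  refine (congrArg (· ≫ _) (ev_app f g _ _ _)).trans ?_
  exact ev_map _ _ _ _

/-- On a vertical arrow, `obcEval` is the component at the identity. -/
theorem obcEval_map_vert {a : A} {e e' : FibHom (sumObj c (yo a)) F} (t : e ⟶ e') :
    (obcEval c F).map (vert t : (⟨a, e⟩ : ObcObj c F) ⟶ ⟨a, e'⟩) =
      FibHom.app t (Over.mk (𝟙 a)) := by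
  refine (congrArg (· ≫ _) (vert_app t (Over.mk (𝟙 a)))).trans ?_
  refine (Category.assoc _ _ _).trans (Eq.trans (congrArg (FibHom.app t (Over.mk (𝟙 a)) ≫ ·) ?_)
    (Category.comp_id _))
  rw [← eqToHom_map e'.toFunctor (over_map_id _).symm]
  refine (e'.map_comp _ _).symm.trans ((congrArg e'.map ?_).trans (e'.map_id _))
  ext
  refine (congrArg (· ≫ _) (Over.eqToHom_left _)).trans ?_
  exact Category.comp_id _

theorem isHomLift_ev {x y : ObcObj c F} (f : x ⟶ y) (w : Over y.base) (l : x.base ⟶ w.left)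
    (h : l ≫ w.hom = ObcHom.base f) : F.p.IsHomLift (p.map l) (ev f w l h) := by
  have h1 : F.p.IsHomLift (𝟙 (p.obj x.base)) (ObcHom.app f (Over.mk (𝟙 x.base))) :=
    BasedNatTrans.isHomLift (F := x.val.toBasedFunctor)
      (G := ((sumMap c (yoMap (ObcHom.base f))).comp y.val).toBasedFunctor) (ObcHom.cell f)
      (a := (Over.mk (𝟙 x.base) : Over x.base)) rfl
  let m : (Over.map (ObcHom.base f)).obj (Over.mk (𝟙 x.base)) ⟶ w :=
    Over.homMk l (h.trans (Category.id_comp (ObcHom.base f)).symm)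
  have h0 : (sumObj c (yo y.base)).p.IsHomLift (p.map l) m :=
    IsHomLift.map (Over.forget y.base ⋙ p) m
  have h2 : F.p.IsHomLift (p.map l) (y.val.map m) :=
    BasedFunctor.preserves_isHomLift y.val.toBasedFunctor (p.map l) m
  exact IsHomLift.comp_lift_id_left' F.p (p.obj x.base) (ObcHom.app f (Over.mk (𝟙 x.base)))
    (p.map l) (y.val.map m)

/-- The components of the 2-cell of a cartesian arrow are invertible: the vertical factor of the
arrow is cartesian over an identity. -/
theorem isIso_app_of_isCart {x y : ObcObj c F} (f : x ⟶ y) (hf : IsCart (obcProj c F) f)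
    (w : Over x.base) : IsIso (ObcHom.app f w) := by
  have h1 : IsCart (obcProj c F) (vert (ObcHom.cell f) : x ⟶ ⟨x.base, _⟩) :=
    isCart_of_comp _ (isCart_obcLift y (ObcHom.base f)) (by rwa [vert_comp_obcLift])
  have h2 : IsIso (vert (ObcHom.cell f) : x ⟶ ⟨x.base, _⟩) :=
    isIso_of_isCart (obcProj c F) _ h1 (inferInstanceAs (IsIso (𝟙 x.base)))
  have := obcFibre_full c F x.base
  have := obcFibre_faithful c F x.base
  have h0 : (obcProj c F).IsHomLift (𝟙 x.base)
      (vert (ObcHom.cell f) : x ⟶ ⟨x.base, _⟩) :=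
    IsHomLift.map (obcProj c F) (vert (ObcHom.cell f) : x ⟶ ⟨x.base, _⟩)
  have h3 : IsIso ((obcFibre c F x.base).map (ObcHom.cell f)) :=
    ⟨⟨@inv _ _ x ⟨x.base, _⟩ (vert (ObcHom.cell f)) h2,
      @IsHomLift.lift_id_inv_isIso _ _ _ _ (obcProj c F) _ x ⟨x.base, _⟩
        (vert (ObcHom.cell f)) h2 h0⟩,
      Subtype.ext (@IsIso.hom_inv_id _ _ x ⟨x.base, _⟩ (vert (ObcHom.cell f)) h2),
      Subtype.ext (@IsIso.inv_hom_id _ _ x ⟨x.base, _⟩ (vert (ObcHom.cell f)) h2)⟩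
  have h4 : IsIso (ObcHom.cell f) := isIso_of_reflects_iso _ (obcFibre c F x.base)
  exact FibHom.isIso_app (ObcHom.cell f) w

theorem isIso_ev {x y : ObcObj c F} (f : x ⟶ y) (w : Over y.base) (l : x.base ⟶ w.left)
    (h : l ≫ w.hom = ObcHom.base f) (hf : IsCart (obcProj c F) f) (hl : IsIso l) :
    IsIso (ev f w l h) := by
  have := isIso_app_of_isCart f hf (Over.mk (𝟙 x.base))
  let m : (Over.map (ObcHom.base f)).obj (Over.mk (𝟙 x.base)) ⟶ w :=
    Over.homMk l (h.trans (Category.id_comp (ObcHom.base f)).symm)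
  have h1 : IsIso ((Over.forget _).map m) := hl
  have h2 : IsIso m := isIso_of_reflects_iso m (Over.forget _)
  have h3 : IsIso (y.val.map m) := inferInstanceAs (IsIso (y.val.toFunctor.map m))
  exact inferInstanceAs (IsIso (_ ≫ y.val.map m))

end ObcHom

end

/-! ### Transposition is an equivalence -/

section

variable {A : Type u₁} [Category.{v₁} A] {B : Type u₂} [Category.{v₂} B] {p : A ⥤ B}

/-- The inverse transposition: a fibred functor `G` on the oplax sum of `E` is sent to the composite
of the unit with the oplax base change of `G`. -/
noncomputable abbrev untranspose (c : Cleavage p) (E : FibCat.{v₃, u₃} A) (F : FibCat.{v, u} B) :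
    FibHom (sumObj c E) F ⥤ FibHom E (obcObj c F) where
  obj G := (unit c E).comp (obcMap c G)
  map α := FibHom.whiskerLeft (unit c E) (obcMap₂ c α)
  map_id G := FibHom.hom_ext fun e => obcMap₂_id_app c G ((unit c E).obj e)
  map_comp α β := FibHom.hom_ext fun e => obcMap₂_comp_app c α β ((unit c E).obj e)

variable (c : Cleavage p) {E : FibCat.{v₃, u₃} A} {F : FibCat.{v, u} B}

/-- The transpose of `untranspose G` acts on arrows as `G` does on the induced arrows between the
chosen lifts of the identities. -/
theorem transpose_untranspose_map (G : FibHom (sumObj c E) F) {e e' : E.obj} (m : e ⟶ e') :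
    ((transpose c E F).obj ((untranspose c E F).obj G)).map m =
      G.map (E.cleavage.hom (𝟙 (E.p.obj e)) (𝟙 (E.p.obj e')) (E.p.map m) m (by simp)) := by
  refine (G.map_comp _ _).symm.trans (congrArg G.map ?_)
  refine (E.cleavage.hom_comp_hom (𝟙 (E.p.obj e)) (𝟙 (E.p.obj e) ≫ E.p.map m) (𝟙 (E.p.obj e'))
    (𝟙 _) (E.p.map m) m (𝟙 e') (by simp) (by simp)).trans ?_
  exact E.cleavage.hom_congr (by simp) (by simp)

/-- The comparison of the transpose of `untranspose G` with `G`: the image under `G` of the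
chosen lifts of the identities. -/
noncomputable def counitHom (G : FibHom (sumObj c E) F) :
    (transpose c E F).obj ((untranspose c E F).obj G) ⟶ G where
  app e := G.map (E.cleavage.map e (𝟙 (E.p.obj e)))
  naturality e e' m := by
    refine (congrArg (· ≫ _) (transpose_untranspose_map c G m)).trans ?_
    refine (G.map_comp _ _).symm.trans (Eq.trans (congrArg G.map ?_) (G.map_comp _ _))
    exact E.cleavage.hom_map _ _ _ _ _
  isHomLift' e := by
    have h1 : (sumObj c E).p.IsHomLift (𝟙 (p.obj (E.p.obj e)))
        (E.cleavage.map e (𝟙 (E.p.obj e))) := by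
      refine IsHomLift.of_fac' _ _ _ (congrArg p.obj (E.cleavage.obj_obj _)) rfl ?_
      refine (congrArg p.map (E.cleavage.map_map (𝟙 (E.p.obj e)))).trans ?_
      simp [eqToHom_map]
    exact @BasedFunctor.preserves_isHomLift _ _ _ _ G.toBasedFunctor _ _ _ _ _ _ h1

theorem isIso_counitHom (G : FibHom (sumObj c E) F) : IsIso (counitHom c G) := by
  refine FibHom.isIso_of_app _ fun e => ?_
  have h : IsIso (E.cleavage.map e (𝟙 (E.p.obj e))) := by
    refine isIso_of_isCart E.p _ (E.cleavage.isCart_map _) ?_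
    rw [E.cleavage.map_map]
    infer_instance
  exact inferInstanceAs (IsIso (G.toFunctor.map (E.cleavage.map e (𝟙 (E.p.obj e)))))

theorem counitHom_naturality {G G' : FibHom (sumObj c E) F} (α : G ⟶ G') :
    (untranspose c E F ⋙ transpose c E F).map α ≫ counitHom c G' = counitHom c G ≫ α := by
  refine FibHom.hom_ext fun e => ?_
  refine Eq.trans (b := FibHom.app α (E.cleavage.obj e (𝟙 (E.p.obj e))) ≫
    G'.map (E.cleavage.map e (𝟙 (E.p.obj e)))) ?_
      ((BasedNatTrans.toNatTrans (F := G.toBasedFunctor) (G := G'.toBasedFunctor)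
    α).naturality (E.cleavage.map e (𝟙 (E.p.obj e)))).symm
  exact congrArg (· ≫ G'.map (E.cleavage.map e (𝟙 (E.p.obj e))))
    (ObcHom.obcEval_map_vert (FibHom.whiskerLeft (sumMap c (classify E e)) α))

/-- The chosen lift of `w` at `e`. -/
noncomputable abbrev liftAt (E : FibCat.{v, u} A) (e : E.obj) (w : Over (E.p.obj e)) :
    (classify E e).obj w ⟶ e := E.cleavage.map e (overArrow w)

/-- The image in `A` of `φ m` is that of `m`, up to transport: the fibred functor `φ` commutes with
the projections only propositionally. -/
theorem base_map (φ : FibHom E (obcObj c F)) {e e' : E.obj} (m : e ⟶ e') :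
    ObcHom.base (φ.map m) = eqToHom (φ.w_obj e) ≫ E.p.map m ≫ eqToHom (φ.w_obj e').symm :=
  Functor.congr_hom φ.w m

/-- The factorization of the image of `φ (liftAt E e w)` at which this arrow is evaluated in
`compareCell`. -/
theorem base_map_liftAt (φ : FibHom E (obcObj c F)) (e : E.obj) (w : Over (E.p.obj e)) :
    eqToHom ((φ.w_obj _).trans (E.cleavage.obj_obj (overArrow w))) ≫
      ((Over.map (eqToHom (φ.w_obj e).symm : E.p.obj e ⟶ (φ.obj e).base)).obj w).hom =
        ObcHom.base (φ.map (liftAt E e w)) := by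
  rw [base_map, E.cleavage.map_map]
  simp

/-- The 2-cell underlying the comparison at `e`: its component at `w` is the evaluation of the image
under `φ` of the chosen lift of `w` at `e`. -/
noncomputable def compareCell (φ : FibHom E (obcObj c F)) (e : E.obj) :
    (sumMap c (classify E e)).comp ((transpose c E F).obj φ) ⟶
      (sumMap c (yoMap (eqToHom (φ.w_obj e).symm))).comp (φ.obj e).val where
  app w := ObcHom.ev (φ.map (liftAt E e w)) _ _ (base_map_liftAt c φ e w)
  naturality w w' h := by
    refine (ObcHom.ev_comp (φ.map ((classify E e).map h)) _ _ _ _).trans (Eq.trans ?_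
      (ObcHom.ev_map _ _ _ _).symm)
    refine ObcHom.ev_congr ?_ ?_
    · refine (φ.map_comp _ _).symm.trans (congrArg φ.map ?_)
      refine (E.cleavage.hom_map _ _ _ _ (by simp)).trans (Category.comp_id _)
    · rw [base_map, E.cleavage.map_hom]
      simp
  isHomLift' w := by
    have h := ObcHom.isHomLift_ev (φ.map (liftAt E e w))
      ((Over.map (eqToHom (φ.w_obj e).symm : E.p.obj e ⟶ (φ.obj e).base)).obj w) (eqToHom _)
      (base_map_liftAt c φ e w)
    rw [eqToHom_map] at h
    exact isHomLift_id_of_eqToHom _ h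

/-- The arrow of the oplax base change with underlying 2-cell `compareCell`. -/
noncomputable abbrev compareArrow (φ : FibHom E (obcObj c F)) (e : E.obj) :
    ((untranspose c E F).obj ((transpose c E F).obj φ)).obj e ⟶ φ.obj e :=
  (⟨eqToHom (φ.w_obj e).symm, compareCell c φ e⟩ : ObcHom c _ _)

theorem base_compareArrow_comp (φ : FibHom E (obcObj c F)) {e e' : E.obj} (m : e ⟶ e') :
    E.p.map m ≫ eqToHom (φ.w_obj e').symm =
      eqToHom (φ.w_obj e).symm ≫ ObcHom.base (φ.map m) := by
  rw [base_map]; simp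

theorem base_map_classifyMap (φ : FibHom E (obcObj c F)) {e e' : E.obj} (m : e ⟶ e')
    (w : Over (E.p.obj e)) : ObcHom.base (φ.map (FibHom.app (classifyMap E m) w)) =
      eqToHom ((φ.w_obj _).trans ((E.cleavage.obj_obj _).trans
        ((E.cleavage.obj_obj _).symm.trans (φ.w_obj _).symm))) := by
  refine (base_map c φ _).trans ((congrArg (fun t => eqToHom _ ≫ t ≫ eqToHom _)
    (E.cleavage.map_hom _ _ _ _ (Category.id_comp (overArrow w ≫ E.p.map m)).symm)).trans ?_)
  exact eqToHom_id_eqToHom _ _ _ _ _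

theorem base_app (φ ψ : FibHom E (obcObj c F)) (θ : φ ⟶ ψ) (e : E.obj) :
    ObcHom.base (FibHom.app θ e) = eqToHom ((φ.w_obj e).trans (ψ.w_obj e).symm) := by
  have h := BasedNatTrans.isHomLift' (F := φ.toBasedFunctor) (G := ψ.toBasedFunctor) θ e
  refine (IsHomLift.fac' (obcProj c F) (𝟙 (E.p.obj e)) (FibHom.app θ e)).trans ?_
  simp

/-- The comparison of `untranspose (φ♯)` with `φ`. -/
noncomputable def compareHom (φ : FibHom E (obcObj c F)) :
    (untranspose c E F).obj ((transpose c E F).obj φ) ⟶ φ where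
  app e := compareArrow c φ e
  naturality e e' m := by
    have hb := base_compareArrow_comp c φ m
    refine ObcHom.ext_app hb fun w => ?_
    refine (congrArg (· ≫ eqToHom _) (ObcHom.catComp_app _ (compareArrow c φ e') w)).trans
      (Eq.trans ?_ (ObcHom.catComp_app (compareArrow c φ e) _ w).symm)
    refine square_eqToHom_aux _ _ _ _ _ _ _ ?_
    -- The two sides are evaluations at objects of `A / a'`, for `a'` the base of `φ.obj e'`, that
    -- are equal only through `hb`.
    have hw : (Over.map (eqToHom (φ.w_obj e').symm : E.p.obj e' ⟶ (φ.obj e').base)).obj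
        ((Over.map (E.p.map m)).obj w) = (Over.map (ObcHom.base (φ.map m))).obj
          ((Over.map (eqToHom (φ.w_obj e).symm : E.p.obj e ⟶ (φ.obj e).base)).obj w) := by
      exact (over_map_comp _ _ w).symm.trans ((congrArg (fun k => (Over.map k).obj w) hb).trans
        (over_map_comp _ _ w))
    refine (congrArg (· ≫ eqToHom _) (ObcHom.ev_comp (φ.map (FibHom.app (classifyMap E m) w))
      _ _ _ (base_map_liftAt c φ e' ((Over.map (E.p.map m)).obj w)))).trans ?_
    refine (ObcHom.ev_eqToHom _ _ _ hw _).trans ?_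
    refine Eq.trans ?_ (ObcHom.ev_app _ _ _ _ (base_map_liftAt c φ e w)).symm
    refine ObcHom.ev_congr ?_ ?_
    · refine (φ.map_comp _ _).symm.trans (Eq.trans (congrArg φ.map ?_) (φ.map_comp _ _))
      exact E.cleavage.hom_map _ _ _ _ (Category.id_comp (overArrow w ≫ E.p.map m)).symm
    · refine (congrArg (fun t => (t ≫ eqToHom _) ≫ eqToHom _)
        (base_map_classifyMap c φ m w)).trans ?_
      exact (eqToHom_comp_eqToHom _ _ _ _)
  isHomLift' e := by
    refine IsHomLift.of_fac' _ _ _ rfl (φ.w_obj e) ?_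
    exact (Category.id_comp _).symm.trans (Category.id_comp _).symm

theorem isIso_compareHom (φ : FibHom E (obcObj c F)) : IsIso (compareHom c φ) := by
  refine FibHom.isIso_of_app _ fun e => ?_
  have h : IsIso (compareCell c φ e) := FibHom.isIso_of_app _ fun w =>
    ObcHom.isIso_ev _ _ _ (base_map_liftAt c φ e w)
      (φ.preserves _ (E.cleavage.isCart_map (overArrow w))) inferInstance
  exact isIso_of_isIso_cell (compareArrow c φ e)
    (inferInstanceAs (IsIso (eqToHom (φ.w_obj e).symm))) h

theorem compareHom_naturality {φ ψ : FibHom E (obcObj c F)} (θ : φ ⟶ ψ) :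
    (transpose c E F ⋙ untranspose c E F).map θ ≫ compareHom c ψ = compareHom c φ ≫ θ := by
  refine FibHom.hom_ext fun e => ?_
  have hb : 𝟙 (E.p.obj e) ≫ eqToHom (ψ.w_obj e).symm =
      eqToHom (φ.w_obj e).symm ≫ ObcHom.base (FibHom.app θ e) := by
    rw [base_app]; simp
  refine ObcHom.ext_app hb fun w => ?_
  refine (congrArg (· ≫ eqToHom _) (ObcHom.catComp_app _ (compareArrow c ψ e) w)).trans
    (Eq.trans ?_ (ObcHom.catComp_app (compareArrow c φ e) _ w).symm)
  refine (congrArg (fun t => (t ≫ _) ≫ eqToHom _) (obcMap₂_app_app c ((transpose c E F).map θ)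
    ((unit c E).obj e) w)).trans ?_
  refine (congrArg (fun t => (_ ≫ t ≫ eqToHom _) ≫ eqToHom _)
    (FibHom.app_eq (compareCell c ψ e) (over_map_id w))).trans ?_
  refine square_eqToHom_aux' _ _ _ _ _ _ _ _ _ _ ?_
  have hw : (Over.map (eqToHom (ψ.w_obj e).symm : E.p.obj e ⟶ (ψ.obj e).base)).obj w =
      (Over.map (ObcHom.base (FibHom.app θ e))).obj
        ((Over.map (eqToHom (φ.w_obj e).symm : E.p.obj e ⟶ (φ.obj e).base)).obj w) := by
    exact (congrArg (fun k => (Over.map k).obj w) ((Category.id_comp _).symm.trans hb)).trans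
      (over_map_comp _ _ w)
  refine (congrArg (· ≫ eqToHom _) (ObcHom.ev_comp (FibHom.app θ _)
    _ _ _ (base_map_liftAt c ψ e w))).trans ?_
  refine (ObcHom.ev_eqToHom _ _ _ hw _).trans ?_
  refine Eq.trans ?_ (ObcHom.ev_app _ _ _ _ (base_map_liftAt c φ e w)).symm
  refine ObcHom.ev_congr ?_ ?_
  · exact ((BasedNatTrans.toNatTrans (F := φ.toBasedFunctor) (G := ψ.toBasedFunctor)
      θ).naturality _).symm
  · refine (congrArg (fun t => (t ≫ eqToHom _) ≫ eqToHom _) (base_app c φ ψ θ _)).trans ?_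
    exact (eqToHom_comp_eqToHom _ _ _ _)

theorem isEquivalence_transpose (c : Cleavage p) (E : FibCat.{v₃, u₃} A) (F : FibCat.{v, u} B) :
    (transpose c E F).IsEquivalence := by
  refine (CategoryTheory.Equivalence.mk (transpose c E F) (untranspose c E F)
    (NatIso.ofComponents (fun φ => @asIso _ _
      ((transpose c E F ⋙ untranspose c E F).obj φ) ((𝟭 _ : FibHom E (obcObj c F) ⥤ _).obj φ)
        (compareHom c φ) (isIso_compareHom c φ)) fun θ => compareHom_naturality c θ).symm
    (NatIso.ofComponents (fun G => @asIso _ _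
      ((untranspose c E F ⋙ transpose c E F).obj G) ((𝟭 _ : FibHom (sumObj c E) F ⥤ _).obj G)
        (counitHom c G) (isIso_counitHom c G)) fun α =>
          counitHom_naturality c α)).isEquivalence_functor

end

/-! ### The pseudo-adjunction -/

section

open Bicategory

variable {A : Type u₁} [Category.{v₁} A] {B : Type u₂} [Category.{v₂} B] {p : A ⥤ B}

/-- A 2-cell is structural if all its components are transports along equalities of objects.
Parallel structural 2-cells are equal. -/
def IsStructural {X : FibCat.{v₃, u₃} A} {Y : FibCat.{v₄, u₄} A} {F G : FibHom X Y} (α : F ⟶ G) :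
    Prop :=
  ∀ x, ∃ h : F.obj x = G.obj x, FibHom.app α x = eqToHom h

namespace IsStructural

variable {X : FibCat.{v₃, u₃} A} {Y : FibCat.{v₄, u₄} A} {Z : FibCat.{v, u} A}

theorem eq {F G : FibHom X Y} {α β : F ⟶ G} (hα : IsStructural α) (hβ : IsStructural β) : α = β :=
  FibHom.hom_ext fun x => by
    obtain ⟨h, h1⟩ := hα x
    obtain ⟨h', h2⟩ := hβ x
    rw [h1, h2]

theorem eqToHom {F G : FibHom X Y} (h : F = G) : IsStructural (CategoryTheory.eqToHom h) :=
  fun x => ⟨by rw [h], FibHom.eqToHom_app h x⟩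

theorem id (F : FibHom X Y) : IsStructural (𝟙 F) :=
  fun _ => ⟨rfl, rfl⟩

theorem comp {F G H : FibHom X Y} {α : F ⟶ G} {β : G ⟶ H} (hα : IsStructural α)
    (hβ : IsStructural β) : IsStructural (α ≫ β) := fun x => by
  obtain ⟨h, h1⟩ := hα x
  obtain ⟨h', h2⟩ := hβ x
  exact ⟨h.trans h', by rw [FibHom.comp_app, h1, h2, eqToHom_trans]⟩

theorem whiskerLeft (F : FibHom X Y) {G H : FibHom Y Z} {α : G ⟶ H} (hα : IsStructural α) :
    IsStructural (FibHom.whiskerLeft F α) :=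
  fun x => hα (F.obj x)

theorem whiskerRight {F G : FibHom X Y} {α : F ⟶ G} (hα : IsStructural α) (H : FibHom Y Z) :
    IsStructural (FibHom.whiskerRight α H) := fun x => by
  obtain ⟨h, h1⟩ := hα x
  refine ⟨congrArg H.obj h, ?_⟩
  exact (congrArg H.map h1).trans (eqToHom_map H.toFunctor h)

theorem sumMap₂ (c : Cleavage p) {F G : FibHom X Y} {α : F ⟶ G} (hα : IsStructural α) :
    IsStructural (sumMap₂ c α) :=
  hα

theorem transpose_map (c : Cleavage p) {F : FibCat.{v, u} B} {φ ψ : FibHom X (obcObj c F)}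
    {θ : φ ⟶ ψ} (hθ : IsStructural θ) : IsStructural ((transpose c X F).map θ) :=
  whiskerRight (sumMap₂ c hθ) (obcEval c F)

theorem shuffle {X₀ X₁ X₂ X₃ X₄ X₅ : FibCat.{v, u} A} (f' : X₀ ⟶ X₁) (f : X₁ ⟶ X₂) (φ : X₂ ⟶ X₃)
    (g : X₃ ⟶ X₄) (g' : X₄ ⟶ X₅) : IsStructural (Fibred.shuffle f' f φ g g') :=
  comp (id _) (whiskerLeft f' (comp (whiskerLeft f (id _)) (id _)))

end IsStructural

theorem obcEval_map_obcMap_map (c : Cleavage p) {F : FibCat.{v, u} B} {G : FibCat.{v₃, u₃} B}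
    (g : FibHom F G) {x y : ObcObj c F} (k : x ⟶ y) :
    (obcEval c G).map ((obcMap c g).map k) = g.map ((obcEval c F).map k) :=
  (g.map_comp _ _).symm

/-- Transposition is strictly natural; the two sides act on arrows by `g (s ≫ t)` and by
`g s ≫ g t`. -/
theorem transpose_natural (c : Cleavage p) {E E' : FibCat.{v₃, u₃} A} {F F' : FibCat.{v, u} B}
    (f : FibHom E' E) (g : FibHom F F') (φ : FibHom E (obcObj c F)) :
    (sumMap c f).comp (((transpose c E F).obj φ).comp g) =
      (transpose c E' F').obj (f.comp (φ.comp (obcMap c g))) := by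
  refine FibHom.ext_toFunctor (CategoryTheory.Functor.ext (fun _ => rfl) fun e e' m => ?_)
  refine (g.map_comp _ _).trans ?_
  exact ((Category.id_comp _).trans (Category.comp_id _)).symm

theorem transpose_natural_app (c : Cleavage p) {E E' : FibCat.{v₃, u₃} A} {F F' : FibCat.{v, u} B}
    (f : FibHom E' E) (g : FibHom F F') (φ : FibHom E (obcObj c F)) (e : E'.obj) :
    FibHom.app (eqToHom (transpose_natural c f g φ)) e = 𝟙 _ :=
  FibHom.eqToHom_app _ _

/-- The pseudo-adjunction between the oplax sum and the oplax base change, with the strict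
equalities `transpose_natural` as pseudo-naturality cells. -/
noncomputable def pseudoAdjunction (c : Cleavage p) : PseudoAdjunction
    (oplaxSum.{max u₁ v₁ w, max u₁ v₁ w w'} c).toPseudofunctor
    (oplaxBaseChange.{w', w} c).toPseudofunctor where
  sharp E F := transpose c E F
  isEquivalence E F := isEquivalence_transpose c E F
  nat f g φ := eqToIso (transpose_natural c f g φ)
  -- In the two naturality laws the pseudo-naturality cells have identity components.
  nat_natural {E' E F F'} f g φ ψ θ := by
    refine FibHom.hom_ext fun e => ?_
    refine (comp_id_eq_id_comp (transpose_natural_app c f g ψ e)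
      (transpose_natural_app c f g φ e)).2 ?_
    exact (obcEval_map_obcMap_map c g _).symm
  nat_natural₂ {E' E F F'} f f' α g g' β φ := by
    refine FibHom.hom_ext fun e => ?_
    refine (comp_id_eq_id_comp (transpose_natural_app c f' g' φ e)
      (transpose_natural_app c f g φ e)).2 ?_
    refine Eq.trans ?_ ((obcEval c F').map_comp
      ((obcMap c g).map (φ.map (FibHom.app α e)))
      (FibHom.app (obcMap₂ c β) (φ.obj (f'.obj e)))).symm
    refine congr (congrArg (· ≫ ·) ?_) ?_
    · exact (obcEval_map_obcMap_map c g _).symm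
    · exact (ObcHom.obcEval_map_vert (FibHom.whiskerLeft (φ.obj (f'.obj e)).val β)).symm
  nat_id E F φ := by
    refine IsStructural.eq ?_ ?_
    · exact ((IsStructural.eqToHom ((oplaxSum c).map_id E)).whiskerRight _).comp
        ((IsStructural.id _).comp (.id _))
    · exact (IsStructural.eqToHom (transpose_natural c (𝟙 E) (𝟙 F) φ)).comp
        (.transpose_map c ((IsStructural.id _).comp
          (((IsStructural.eqToHom ((oplaxBaseChange c).map_id F)).whiskerLeft _).comp (.id _))))
  nat_comp f' f g g' φ := by
    refine IsStructural.eq ?_ ?_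
    · exact ((IsStructural.eqToHom ((oplaxSum c).map_comp f' f)).whiskerRight _).comp
        ((IsStructural.shuffle _ _ _ _ _).comp
          ((((IsStructural.eqToHom (transpose_natural c f g φ)).whiskerRight _).whiskerLeft _).comp
            (.eqToHom (transpose_natural c f' g' (f ≫ φ ≫ (oplaxBaseChange c).map g)))))
    · exact (IsStructural.eqToHom (transpose_natural c (f' ≫ f) (g ≫ g') φ)).comp
        (.transpose_map c
          ((((IsStructural.eqToHom ((oplaxBaseChange c).map_comp g g')).whiskerLeft _).whiskerLeft
            _).comp (.shuffle _ _ _ _ _)))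

end

end Fibred

theorem mainTheorem1 {A : Type u₁} [Category.{v₁} A] {B : Type u₂} [Category.{v₂} B]
    (p : A ⥤ B) (c : Fibred.Cleavage p) :
    (∀ (F : Fibred.FibCat.{v, u} B) (a : A),
      ∃ G : (Fibred.obcObj c F).p.Fiber a ⥤ Fibred.FibHom (Fibred.sumObj c (Fibred.yo a)) F,
        Fibred.obcFibre c F a ⋙ G = 𝟭 (Fibred.FibHom (Fibred.sumObj c (Fibred.yo a)) F) ∧
          G ⋙ Fibred.obcFibre c F a = 𝟭 ((Fibred.obcObj c F).p.Fiber a)) ∧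
    ∃ adj : Fibred.PseudoAdjunction
        (Fibred.oplaxSum.{max u₁ v₁ w, max u₁ v₁ w w'} c).toPseudofunctor
        (Fibred.oplaxBaseChange.{w', w} c).toPseudofunctor,
      (∀ (E : Fibred.FibCat.{max u₁ v₁ w, max u₁ v₁ w w'} A)
          (F : Fibred.FibCat.{max u₁ v₁ w, max u₁ v₁ w w'} B),
        adj.sharp E F = Fibred.transpose c E F) ∧
      ∀ {E E' : Fibred.FibCat.{max u₁ v₁ w, max u₁ v₁ w w'} A}
          {F F' : Fibred.FibCat.{max u₁ v₁ w, max u₁ v₁ w w'} B} (f : E' ⟶ E) (g : F ⟶ F')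
          (φ : E ⟶ (Fibred.oplaxBaseChange.{w', w} c).obj F),
        ∃ h : _ = _, adj.nat f g φ = eqToIso h :=
  ⟨fun F a => Fibred.exists_inverse_obcFibre c F a, Fibred.pseudoAdjunction.{w', w} c,
    fun _ _ => rfl, fun f g φ => ⟨Fibred.transpose_natural c f g φ, rfl⟩⟩
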